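/- Let $K$ be a field and let $S = K[x_1,\dots,x_n]$ be the polynomial ring with the standard grading $\deg(x_i)=1$. For a finitely generated $\mathbb{Z}$-graded $S$-module $M$ let $\beta_{i,j}(M) = \dim_K \operatorname{Tor}_i^S(M,K)_j$ denote its graded Betti numbers, and for $M \neq 0$ let $\beta_i^{lin}(M) = \beta_{i,i+d}(M)$, where $d = \min\{e \in \mathbb{Z} : M_e \neq 0\}$ is the initial degree of $M$. Let $k \geq 0$ be an integer, let $p \in \{0,\dots,n\}$, and let $M$ be a nonzero finitely generated graded $S$-module which is, up to isomorphism of graded modules, the $k$-th syzygy module in a minimal graded free resolution $\cdots \to F_1 \to F_0 \to N \to 0$ of some finitely generated graded $S$-module $N$ (so $M \cong N$ if $k=0$, $M \cong \ker(F_0 \to N)$ if $k=1$, and $M \cong \ker(F_{k-1}\to F_{k-2})$ if $k \geq 2$). Suppose that $\beta_p^{lin}(M) \neq 0$. Then: (i) If $k = 0$, then $\beta_i^{lin}(M) \geq \binom{p}{i}$ for $i = 0,\dots,p$. (ii) If $k = 1$, then $\beta_i^{lin}(M) \geq \binom{p+1}{i+1}$ for $i = 0,\dots,p$. (iii) If $k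 > 1$ and $p > 0$, then $\beta_{p-1}^{lin}(M) \geq p + k$. -/

import Mathlib

open MvPolynomial
open scoped TensorProduct

namespace LinearStrand

/-- The polynomial ring `S = K[x₁, …, xₙ]`. -/
abbrev Poly (K : Type*) [Field K] (n : ℕ) : Type _ := MvPolynomial (Fin n) K

/-- The standard `ℤ`-grading of `S`, with `deg xᵢ = 1` (so `S_d = 0` for `d < 0`). -/
noncomputable abbrev stdGrading (K : Type*) [Field K] (n : ℕ) : ℤ → Submodule K (Poly K n) :=
  weightedHomogeneousSubmodule K (fun _ : Fin n => (1 : ℤ))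

/-- The graded maximal ideal `𝔪 = (x₁, …, xₙ)`. -/
noncomputable abbrev maxIdeal (K : Type*) [Field K] (n : ℕ) : Ideal (Poly K n) :=
  idealOfVars (Fin n) K

/-- The residue field `S / 𝔪`, i.e. `K` as an `S`-module (concentrated in degree `0`). -/
abbrev ResField (K : Type*) [Field K] (n : ℕ) : Type _ := Poly K n ⧸ maxIdeal K n

/-- The grading of the graded free module `⨁ₐ S(-deg a)`, whose `a`-th basis vector has degree
`deg a`: a vector is homogeneous of degree `e` iff its `a`-th entry lies in `S_{e - deg a}`. -/
noncomputable def freeGrading (K : Type*) [Field K] (n : ℕ) {r : ℕ} (deg : Fin r → ℤ) (e : ℤ) :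
    Submodule K (Fin r → Poly K n) :=
  Submodule.pi Set.univ fun a => stdGrading K n (e - deg a)

/-- The degree `e` part of `F ⊗ S/𝔪` for the graded free module `F = ⨁ₐ S(-deg a)`: the image of
`F_e` under `f ↦ f ⊗ 1`. -/
noncomputable def tensorGrading (K : Type*) [Field K] (n : ℕ) {r : ℕ} (deg : Fin r → ℤ) (e : ℤ) :
    Submodule K ((Fin r → Poly K n) ⊗[Poly K n] ResField K n) :=
  (freeGrading K n deg e).map
    (((TensorProduct.mk (Poly K n) (Fin r → Poly K n) (ResField K n)).flip 1).restrictScalars K)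

/-- A graded free resolution `⋯ → F₁ → F₀ → N → 0` of a graded `S`-module `N` by graded free
modules of finite rank; all maps are homogeneous of degree `0`. -/
structure GradedFreeResolution {K : Type*} [Field K] {n : ℕ} {N : Type*} [AddCommGroup N]
    [Module K N] [Module (Poly K n) N] (𝒩 : ℤ → Submodule K N) where
  /-- the rank of `Fᵢ` -/
  rank : ℕ → ℕ
  /-- the degrees of the basis elements of `Fᵢ` -/
  deg : (i : ℕ) → Fin (rank i) → ℤ
  /-- the differential `Fᵢ₊₁ → Fᵢ` -/
  d : (i : ℕ) → (Fin (rank (i + 1)) → Poly K n) →ₗ[Poly K n] (Fin (rank i) → Poly K n)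
  /-- the augmentation `F₀ → N` -/
  aug : (Fin (rank 0) → Poly K n) →ₗ[Poly K n] N
  d_mem : ∀ (i : ℕ) (e : ℤ), ∀ v ∈ freeGrading K n (deg (i + 1)) e,
    d i v ∈ freeGrading K n (deg i) e
  aug_mem : ∀ e : ℤ, ∀ v ∈ freeGrading K n (deg 0) e, aug v ∈ 𝒩 e
  exact_d : ∀ i : ℕ, Function.Exact (d (i + 1)) (d i)
  exact_aug : Function.Exact (d 0) aug
  aug_surjective : Function.Surjective aug

namespace GradedFreeResolution

variable {K : Type*} [Field K] {n : ℕ} {N : Type*} [AddCommGroup N]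
  [Module K N] [Module (Poly K n) N] {𝒩 : ℤ → Submodule K N}

/-- The resolution is minimal: the image of every differential lies in `𝔪 Fᵢ`. -/
def IsMinimal (F : GradedFreeResolution (n := n) 𝒩) : Prop :=
  ∀ i : ℕ, LinearMap.range (F.d i) ≤ maxIdeal K n • ⊤

/-- `F.IsSyzygy k ℳ`: the graded module `(M, ℳ)` is, up to an isomorphism of graded `S`-modules,
the `k`-th syzygy module in the resolution `F` of `N`. The `0`-th one is `N` itself, the first one is
`ker (F₀ → N)`, and the `(j+2)`-nd one is `ker (Fⱼ₊₁ → Fⱼ)`. -/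
def IsSyzygy (F : GradedFreeResolution (n := n) 𝒩) {M : Type*} [AddCommGroup M] [Module K M]
    [Module (Poly K n) M] : ℕ → (ℤ → Submodule K M) → Prop
  | 0, ℳ => ∃ φ : M ≃ₗ[Poly K n] N, ∀ (e : ℤ) (m : M), m ∈ ℳ e ↔ φ m ∈ 𝒩 e
  | 1, ℳ => ∃ φ : M ≃ₗ[Poly K n] LinearMap.ker F.aug, ∀ (e : ℤ) (m : M),
      m ∈ ℳ e ↔ (φ m : Fin (F.rank 0) → Poly K n) ∈ freeGrading K n (F.deg 0) e
  | j + 2, ℳ => ∃ φ : M ≃ₗ[Poly K n] LinearMap.ker (F.d j), ∀ (e : ℤ) (m : M),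
      m ∈ ℳ e ↔ (φ m : Fin (F.rank (j + 1)) → Poly K n) ∈ freeGrading K n (F.deg (j + 1)) e

/-- The differential `Fᵢ₊₁ ⊗ S/𝔪 → Fᵢ ⊗ S/𝔪`. -/
noncomputable def tensorD (F : GradedFreeResolution (n := n) 𝒩) (i : ℕ) :
    ((Fin (F.rank (i + 1)) → Poly K n) ⊗[Poly K n] ResField K n) →ₗ[Poly K n]
      ((Fin (F.rank i) → Poly K n) ⊗[Poly K n] ResField K n) :=
  (F.d i).rTensor (ResField K n)

/-- The cycles of the complex `F ⊗ S/𝔪` in homological degree `i`. -/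
noncomputable def torCycles (F : GradedFreeResolution (n := n) 𝒩) :
    (i : ℕ) → Submodule (Poly K n) ((Fin (F.rank i) → Poly K n) ⊗[Poly K n] ResField K n)
  | 0 => ⊤
  | i + 1 => LinearMap.ker (F.tensorD i)

/-- The boundaries of the complex `F ⊗ S/𝔪` in homological degree `i`. -/
noncomputable def torBoundaries (F : GradedFreeResolution (n := n) 𝒩) (i : ℕ) :
    Submodule (Poly K n) ((Fin (F.rank i) → Poly K n) ⊗[Poly K n] ResField K n) :=
  LinearMap.range (F.tensorD i)

/-- `Torᵢ(N, K)_j`, computed by the resolution `F`: the classes modulo boundaries of the cycles of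
degree `j` of `F ⊗ S/𝔪` in homological degree `i`. It is realised as a `K`-subspace of the quotient
of `Fᵢ ⊗ S/𝔪` by the boundaries. -/
noncomputable def tor (F : GradedFreeResolution (n := n) 𝒩) (i : ℕ) (j : ℤ) :
    Submodule K (((Fin (F.rank i) → Poly K n) ⊗[Poly K n] ResField K n) ⧸ F.torBoundaries i) :=
  ((F.torCycles i).restrictScalars K ⊓ tensorGrading K n (F.deg i) j).map
    ((F.torBoundaries i).mkQ.restrictScalars K)

end GradedFreeResolution

open Classical in
/-- The graded Betti number `β_{i,j}(M) = dim_K Torᵢ(M, K)_j`, where `Tor` is computed by a graded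
free resolution of `M`. Over the noetherian ring `S` every finitely generated graded module has
such a resolution, and `Tor` does not depend on it. -/
noncomputable def gradedBetti {K : Type*} [Field K] (n : ℕ) {M : Type*} [AddCommGroup M]
    [Module K M] [Module (Poly K n) M] (ℳ : ℤ → Submodule K M) (i : ℕ) (j : ℤ) : ℕ :=
  if h : Nonempty (GradedFreeResolution (n := n) ℳ) then
    Module.finrank K (h.some.tor i j)
  else 0

/-- The initial degree of a nonzero finitely generated graded module: the least `d` with
`M_d ≠ 0`. -/
noncomputable def initialDegree {K : Type*} [Field K] {M : Type*} [AddCommGroup M] [Module K M]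
    (ℳ : ℤ → Submodule K M) : ℤ :=
  sInf {d : ℤ | ℳ d ≠ ⊥}

/-- `βᵢ^lin(M) = β_{i,i+d}(M)`, where `d` is the initial degree of `M`. -/
noncomputable def linBetti {K : Type*} [Field K] (n : ℕ) {M : Type*} [AddCommGroup M]
    [Module K M] [Module (Poly K n) M] (ℳ : ℤ → Submodule K M) (i : ℕ) : ℕ :=
  gradedBetti n ℳ i (i + initialDegree ℳ)

end LinearStrand

/-! Let d be the initial degree of M. The double complex formed from the Koszul complex of x_1, …,
x_n and a free resolution of M has exact rows and columns away from its edges. Zigzags through it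
compare Tor_i(M,K)_{i+d} with Koszul homology of M having coefficients in M_d. Boundaries vanish
there, since they would come from coefficients in M_{d-1} = 0. What remains are cycles
(`linearCycles`): alternating maps z on (K^n)^i with values in M_d such that Σ x_j z(…, e_j, …) = 0
in every slot. Two consequences are used: a nonzero class yields a nonzero cycle
(`exists_linearCycle_ne_zero`), and the dimension of the cycles is at most β_i^lin
(`rank_linearCycles_le`).

Take a nonzero cycle z in p arguments and v with z(v) ≠ 0. Freezing the arguments v_s outside an
i-subset of slots gives a cycle in i arguments, and these cycles are independent, which proves (i).

A first syzygy lies in a free module, so a coordinate turns z into a nonzero polynomial-valued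
cycle. Over the fraction field, the values and first partial derivatives of cycles supply, besides
the C(p,i) contractions, another C(p,i+1) independent vectors: combinations Σ x_j(…) whose values
vanish by the cycle relation but whose derivatives do not, by the Leibniz rule
(`choose_succ_le_finrank_of_cycle`).

For (iii), let q be the rank of u ↦ z(u, ·), a map into the cycles in p-1 arguments. Then z descends
to K^q as a Koszul cycle for q independent linear forms. A k-th syzygy has no Koszul homology for
them in positive degrees above q-k, so q < p+k would make z a boundary, hence zero
(`add_le_finrank_linearCycles`). -/

namespace LinearStrand

/-! ### The Koszul complex in terms of alternating maps, and its exactness for regular sequences. -/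

section Koszul

variable {K R : Type*} [Field K] [CommRing R] [Algebra K R]
  {M M' : Type*} [AddCommGroup M] [Module K M] [Module R M] [IsScalarTower K R M]
  [AddCommGroup M'] [Module K M'] [Module R M'] [IsScalarTower K R M']
  {V : Type*} [AddCommGroup V] [Module K V] {q a : ℕ}

lemma alternatingMap_sum_apply {ι κ : Type*} (s : Finset ι) (w : ι → V [⋀^κ]→ₗ[K] M)
    (v : κ → V) : (∑ j ∈ s, w j) v = ∑ j ∈ s, w j v := by
  induction s using Finset.cons_induction with
  | empty => simp
  | cons j s hj ih => simp [ih]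

/-- The Koszul differential of the sequence `f`, acting on alternating maps with values in `M`. -/
noncomputable def koszulD (f : Fin q → R) (a : ℕ) (z : (Fin q → K) [⋀^Fin (a + 1)]→ₗ[K] M) :
    (Fin q → K) [⋀^Fin a]→ₗ[K] M :=
  ∑ j, f j • z.curryLeft (Pi.single j 1)

lemma koszulD_eq (f : Fin q → R) (z : (Fin q → K) [⋀^Fin (a + 1)]→ₗ[K] M) :
    koszulD f a z = ∑ j, f j • z.curryLeft (Pi.single j 1) := rfl

variable (K M) in
/-- The Koszul differential as a linear map. -/
noncomputable def koszulDLin (f : Fin q → R) (a : ℕ) :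
    ((Fin q → K) [⋀^Fin (a + 1)]→ₗ[K] M) →ₗ[K] ((Fin q → K) [⋀^Fin a]→ₗ[K] M) where
  toFun z := koszulD f a z
  map_add' z w := by
    simp [koszulD_eq, Finset.sum_add_distrib]
  map_smul' c z := by
    simp only [koszulD_eq, AlternatingMap.curryLeft_smul, LinearMap.smul_apply, RingHom.id_apply,
      Finset.smul_sum]
    exact Finset.sum_congr rfl fun j _ => smul_comm _ _ _

lemma koszulD_add (f : Fin q → R) (z w : (Fin q → K) [⋀^Fin (a + 1)]→ₗ[K] M) :
    koszulD f a (z + w) = koszulD f a z + koszulD f a w :=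
  (koszulDLin K M f a).map_add z w

lemma koszulD_sub (f : Fin q → R) (z w : (Fin q → K) [⋀^Fin (a + 1)]→ₗ[K] M) :
    koszulD f a (z - w) = koszulD f a z - koszulD f a w :=
  (koszulDLin K M f a).map_sub z w

@[simp]
lemma koszulD_zero (f : Fin q → R) :
    koszulD f a (0 : (Fin q → K) [⋀^Fin (a + 1)]→ₗ[K] M) = 0 :=
  (koszulDLin K M f a).map_zero

lemma koszulD_sum {ι : Type*} (s : Finset ι) (f : Fin q → R)
    (z : ι → (Fin q → K) [⋀^Fin (a + 1)]→ₗ[K] M) :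
    koszulD f a (∑ i ∈ s, z i) = ∑ i ∈ s, koszulD f a (z i) :=
  map_sum (koszulDLin K M f a) z s

lemma koszulD_apply (f : Fin q → R) (z : (Fin q → K) [⋀^Fin (a + 1)]→ₗ[K] M)
    (v : Fin a → Fin q → K) :
    koszulD f a z v = ∑ j, f j • z (Matrix.vecCons (Pi.single j 1) v) := by
  simp [koszulD_eq, alternatingMap_sum_apply]

lemma curryLeft_curryLeft_swap (z : V [⋀^Fin (a + 2)]→ₗ[K] M) (u v : V) :
    (z.curryLeft u).curryLeft v = -(z.curryLeft v).curryLeft u := by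
  have h := AlternatingMap.curryLeft_same z (u + v)
  simp only [map_add, AlternatingMap.curryLeft_add, LinearMap.add_apply,
    AlternatingMap.curryLeft_same, zero_add, add_zero] at h
  exact eq_neg_of_add_eq_zero_right h

lemma curryLeft_sum_apply {ι : Type*} (s : Finset ι) (w : ι → V [⋀^Fin (a + 1)]→ₗ[K] M) (u : V) :
    (∑ j ∈ s, w j).curryLeft u = ∑ j ∈ s, (w j).curryLeft u := by
  ext v
  simp [alternatingMap_sum_apply]

lemma curryLeft_sub_apply (z w : V [⋀^Fin (a + 1)]→ₗ[K] M) (u : V) :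
    (z - w).curryLeft u = z.curryLeft u - w.curryLeft u := rfl

lemma curryLeft_koszulD (f : Fin q → R) (z : (Fin q → K) [⋀^Fin (a + 2)]→ₗ[K] M)
    (u : Fin q → K) :
    (koszulD f (a + 1) z).curryLeft u = -koszulD f a (z.curryLeft u) := by
  ext v
  simp only [AlternatingMap.curryLeft_apply_apply, koszulD_apply, AlternatingMap.neg_apply,
    ← Finset.sum_neg_distrib]
  refine Finset.sum_congr rfl fun j _ => ?_
  rw [← smul_neg]
  congr 1
  exact DFunLike.congr_fun (curryLeft_curryLeft_swap z (Pi.single j 1) u) v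

lemma koszulD_koszulD (f : Fin q → R) (z : (Fin q → K) [⋀^Fin (a + 2)]→ₗ[K] M) :
    koszulD f a (koszulD f (a + 1) z) = 0 := by
  rw [koszulD_eq]
  simp only [curryLeft_koszulD]
  simp only [koszulD_eq, smul_neg, Finset.smul_sum, Finset.sum_neg_distrib]
  rw [neg_eq_zero]
  refine Finset.sum_involution (s := Finset.univ ×ˢ Finset.univ) (f := fun p : Fin q × Fin q =>
    f p.1 • f p.2 • (z.curryLeft (Pi.single p.1 1)).curryLeft (Pi.single p.2 1))
    (fun p _ => p.swap) ?_ ?_ ?_ ?_ |> fun h => by rwa [Finset.sum_product] at h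
  · intro p _
    simp only [Prod.fst_swap, Prod.snd_swap]
    rw [curryLeft_curryLeft_swap z (Pi.single p.2 1) (Pi.single p.1 1), smul_comm (f p.2) (f p.1),
      smul_neg, smul_neg, add_neg_cancel]
  · rintro ⟨i, j⟩ _ h hij
    simp only [Prod.swap_prod_mk, Prod.mk.injEq] at hij
    simp [hij.1] at h
  · simp
  · simp

lemma koszulD_compAlternatingMap (f : Fin q → R) (φ : M →ₗ[K] M')
    (hφ : ∀ (j : Fin q) (m : M), φ (f j • m) = f j • φ m)
    (z : (Fin q → K) [⋀^Fin (a + 1)]→ₗ[K] M) :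
    koszulD f a (φ.compAlternatingMap z) = φ.compAlternatingMap (koszulD f a z) := by
  ext v
  simp [koszulD_apply, hφ]

/-- The exterior product of a linear form with an alternating map. -/
noncomputable def wedge (φ : V →ₗ[K] K) (w : V [⋀^Fin a]→ₗ[K] M) :
    V [⋀^Fin (a + 1)]→ₗ[K] M :=
  AlternatingMap.alternatizeUncurryFin (φ.smulRight w)

lemma wedge_apply (φ : V →ₗ[K] K) (w : V [⋀^Fin a]→ₗ[K] M) (v : Fin (a + 1) → V) :
    wedge φ w v = ∑ i : Fin (a + 1), (-1) ^ (i : ℕ) • φ (v i) • w (i.removeNth v) := by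
  simp [wedge, AlternatingMap.alternatizeUncurryFin_apply]

lemma curryLeft_wedge_zero (φ : V →ₗ[K] K) (w : V [⋀^Fin 0]→ₗ[K] M) (u : V) :
    (wedge φ w).curryLeft u = φ u • w := by
  ext v
  simp only [AlternatingMap.curryLeft_apply_apply, wedge_apply, AlternatingMap.smul_apply]
  simp [Subsingleton.elim _ v]

lemma curryLeft_wedge (φ : V →ₗ[K] K) (w : V [⋀^Fin (a + 1)]→ₗ[K] M) (u : V) :
    (wedge φ w).curryLeft u = φ u • w - wedge φ (w.curryLeft u) := by
  ext v
  simp only [AlternatingMap.curryLeft_apply_apply, wedge_apply, AlternatingMap.smul_apply,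
    AlternatingMap.sub_apply]
  rw [Fin.sum_univ_succ, sub_eq_add_neg, ← Finset.sum_neg_distrib]
  congr 1
  · simp only [Fin.val_zero, pow_zero, one_smul, Matrix.cons_val_zero]
    rfl
  · refine Finset.sum_congr rfl fun i _ => ?_
    simp only [Fin.val_succ, pow_succ, mul_neg_one, neg_smul, Matrix.cons_val_succ]
    congr 3
    congr 1
    exact Fin.cons_comp_succ_succAbove _ _ _

@[simp]
lemma wedge_zero (φ : V →ₗ[K] K) : wedge φ (0 : V [⋀^Fin a]→ₗ[K] M) = 0 := by
  ext v
  simp [wedge_apply]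

lemma wedge_sum_smul {ι : Type*} (s : Finset ι) (φ : V →ₗ[K] K) (r : ι → R)
    (w : ι → V [⋀^Fin a]→ₗ[K] M) :
    wedge φ (∑ j ∈ s, r j • w j) = ∑ j ∈ s, r j • wedge φ (w j) := by
  ext v
  simp only [wedge_apply, alternatingMap_sum_apply, AlternatingMap.smul_apply, Finset.smul_sum]
  rw [Finset.sum_comm]
  refine Finset.sum_congr rfl fun j _ => Finset.sum_congr rfl fun i _ => ?_
  rw [smul_comm (r j), smul_comm (r j)]

/-- Exterior multiplication by the k-th coordinate is a homotopy between multiplication by f_k and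
zero; this is what removes one variable at a time from a cycle. -/
lemma koszulD_wedge (f : Fin q → R) (k : Fin q) (w : (Fin q → K) [⋀^Fin (a + 1)]→ₗ[K] M) :
    koszulD f (a + 1) (wedge (LinearMap.proj k) w) =
      f k • w - wedge (LinearMap.proj k) (koszulD f a w) := by
  rw [koszulD_eq, koszulD_eq, wedge_sum_smul]
  simp only [curryLeft_wedge, smul_sub, Finset.sum_sub_distrib, LinearMap.proj_apply]
  congr 1
  rw [Finset.sum_eq_single k]
  · simp
  · intro j _ hj
    simp [Pi.single_eq_of_ne hj.symm]
  · simp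

lemma koszulD_wedge_zero (f : Fin q → R) (k : Fin q) (w : (Fin q → K) [⋀^Fin 0]→ₗ[K] M) :
    koszulD f 0 (wedge (LinearMap.proj k) w) = f k • w := by
  rw [koszulD_eq]
  simp only [curryLeft_wedge_zero, LinearMap.proj_apply]
  rw [Finset.sum_eq_single k]
  · simp
  · intro j _ hj
    simp [Pi.single_eq_of_ne hj.symm]
  · simp

/-- `f` is a regular sequence on `M` (read from right to left), without the condition that
`M ≠ (f) M`. -/
def IsRegularSeq (f : Fin q → R) (M : Type*) [AddCommGroup M] [Module R M] : Prop :=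
  ∀ (k : Fin q) (m : M) (g : Fin q → M), f k • m = ∑ j ∈ Finset.Ioi k, f j • g j →
    ∃ g' : Fin q → M, m = ∑ j ∈ Finset.Ioi k, f j • g' j

lemma alternatingMap_eq_zero_of_curryLeft (z : (Fin q → K) [⋀^Fin (a + 1)]→ₗ[K] M)
    (hz : ∀ j, z.curryLeft (Pi.single j 1) = 0) : z = 0 := by
  have h : z.curryLeft = 0 := (Pi.basisFun K (Fin q)).ext fun j => by simpa using hz j
  ext v
  have := DFunLike.congr_fun (LinearMap.congr_fun h (v 0)) (Matrix.vecTail v)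
  rw [AlternatingMap.curryLeft_apply_apply] at this
  rw [← Matrix.cons_head_tail v]
  exact this

/-- Induction on the number t of variables that z may still involve. The slice of z along the
variable κ is a cycle in the later variables, hence a boundary: by induction in positive degree, by
regularity of f_κ modulo the later f_j in degree zero. -/
theorem exists_koszulD_eq_of_killed {f : Fin q → R} (hf : IsRegularSeq f M) (t k : ℕ)
    (hk : k + t = q) (a : ℕ) (z : (Fin q → K) [⋀^Fin (a + 1)]→ₗ[K] M)
    (hz : ∀ j : Fin q, (j : ℕ) < k → z.curryLeft (Pi.single j 1) = 0) (hd : koszulD f a z = 0) :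
    ∃ w : (Fin q → K) [⋀^Fin (a + 2)]→ₗ[K] M,
      (∀ j : Fin q, (j : ℕ) < k → w.curryLeft (Pi.single j 1) = 0) ∧ koszulD f (a + 1) w = z := by
  induction t generalizing k a with
  | zero =>
    have : z = 0 := alternatingMap_eq_zero_of_curryLeft z fun j => hz j (by omega)
    exact ⟨0, by simp, by simp [this]⟩
  | succ t ih =>
    obtain ⟨κ, rfl⟩ : ∃ κ : Fin q, (κ : ℕ) = k := ⟨⟨k, by omega⟩, rfl⟩
    let e : Fin q → Fin q → K := fun j => Pi.single j 1
    -- the slice of `z` along the new variable is a boundary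
    have hslice : ∃ w : (Fin q → K) [⋀^Fin (a + 1)]→ₗ[K] M,
        (∀ j : Fin q, (j : ℕ) < κ + 1 → w.curryLeft (e j) = 0) ∧
          koszulD f a w = z.curryLeft (e κ) := by
      cases a with
      | zero =>
        have h0 : ∑ j, f j • z (Matrix.vecCons (e j) ![]) = 0 := by
          rw [← koszulD_apply, hd]; rfl
        have h1 : f κ • z (Matrix.vecCons (e κ) ![]) =
            ∑ j ∈ Finset.Ioi κ, f j • -z (Matrix.vecCons (e j) ![]) := by
          have hdec : ∑ j, f j • z (Matrix.vecCons (e j) ![]) =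
              ∑ j ∈ Finset.Ici κ, f j • z (Matrix.vecCons (e j) ![]) := by
            symm
            refine Finset.sum_subset (Finset.subset_univ _) fun j _ hj => ?_
            rw [Finset.mem_Ici, not_le] at hj
            have := DFunLike.congr_fun (hz j hj) ![]
            simp only [AlternatingMap.curryLeft_apply_apply] at this
            rw [this]; simp
          rw [hdec, ← Finset.Ioi_insert, Finset.sum_insert (by simp)] at h0
          simp only [smul_neg, Finset.sum_neg_distrib]
          exact eq_neg_of_add_eq_zero_left h0
        obtain ⟨g, hg⟩ := hf κ _ _ h1
        refine ⟨∑ j ∈ Finset.Ioi κ, wedge (LinearMap.proj j)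
          (AlternatingMap.constOfIsEmpty K (Fin q → K) (Fin 0) (g j)), ?_, ?_⟩
        · intro i hi
          rw [curryLeft_sum_apply]
          simp only [curryLeft_wedge_zero]
          refine Finset.sum_eq_zero fun j hj => ?_
          rw [Finset.mem_Ioi, Fin.lt_def] at hj
          have : j ≠ i := by rintro rfl; omega
          simp [e, Pi.single_eq_of_ne this]
        · rw [koszulD_sum]
          simp only [koszulD_wedge_zero]
          ext v
          rw [Subsingleton.elim v ![]]
          simp only [alternatingMap_sum_apply, AlternatingMap.smul_apply,
            AlternatingMap.curryLeft_apply_apply, hg]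
          rfl
      | succ a =>
        refine ih (κ + 1) (by omega) a _ ?_ ?_
        · intro j hj
          rcases Nat.lt_succ_iff_lt_or_eq.mp hj with hj | hj
          · rw [curryLeft_curryLeft_swap, hz j hj]; simp
          · rw [Fin.ext hj]; exact AlternatingMap.curryLeft_same z (e κ)
        · have := curryLeft_koszulD f z (e κ)
          rw [hd] at this
          simpa using this.symm
    obtain ⟨w, hw, hwz⟩ := hslice
    have hpw : koszulD f (a + 1) (wedge (LinearMap.proj κ) w) =
        f κ • w - wedge (LinearMap.proj κ) (z.curryLeft (e κ)) := by
      rw [koszulD_wedge, hwz]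
    -- Modulo f_κ w, which does not involve κ, the added boundary is minus the part of z containing
    -- κ. The sum is therefore a cycle in the later variables only.
    obtain ⟨w', hw', hwz'⟩ := ih (κ + 1) (by omega) a
      (z + koszulD f (a + 1) (wedge (LinearMap.proj κ) w)) (by
        intro j hj
        have hsm : (f κ • w).curryLeft (e j) = f κ • w.curryLeft (e j) := rfl
        rw [hpw]
        change z.curryLeft (e j) + ((f κ • w).curryLeft (e j) - (wedge (LinearMap.proj κ)
          (z.curryLeft (e κ))).curryLeft (e j)) = 0
        rw [hsm, hw j hj, smul_zero, zero_sub]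
        have hwd : (wedge (LinearMap.proj κ) (z.curryLeft (e κ))).curryLeft (e j) =
            (e j κ) • z.curryLeft (e κ) := by
          cases a with
          | zero => rw [curryLeft_wedge_zero]; rfl
          | succ a =>
            rw [curryLeft_wedge]
            have : (z.curryLeft (e κ)).curryLeft (e j) = 0 := by
              rcases Nat.lt_succ_iff_lt_or_eq.mp hj with hj | hj
              · rw [curryLeft_curryLeft_swap, hz j hj]; simp
              · rw [Fin.ext hj]; simp
            rw [this]
            simp
        rw [hwd]
        rcases Nat.lt_succ_iff_lt_or_eq.mp hj with hj | hj
        · have : κ ≠ j := by rintro rfl; omega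
          rw [hz j hj]
          simp [e, Pi.single_eq_of_ne this]
        · rw [Fin.ext hj]; simp [e])
      (by rw [koszulD_add, hd, koszulD_koszulD, add_zero])
    refine ⟨w' - wedge (LinearMap.proj κ) w, ?_, by rw [koszulD_sub, hwz']; simp⟩
    intro j hj
    have h1 := hw' j (by omega)
    have h2 : κ ≠ j := by rintro rfl; omega
    rw [curryLeft_sub_apply, h1, curryLeft_wedge, hw j (by omega)]
    simp [Pi.single_eq_of_ne h2]

theorem exists_koszulD_eq {f : Fin q → R} (hf : IsRegularSeq f M)
    (z : (Fin q → K) [⋀^Fin (a + 1)]→ₗ[K] M) (hd : koszulD f a z = 0) :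
    ∃ w : (Fin q → K) [⋀^Fin (a + 2)]→ₗ[K] M, koszulD f (a + 1) w = z := by
  obtain ⟨w, -, h⟩ := exists_koszulD_eq_of_killed hf q 0 (by simp) a z (by simp) hd
  exact ⟨w, h⟩

lemma IsRegularSeq.pi {f : Fin q → R} (hf : IsRegularSeq f R) (ι : Type*) :
    IsRegularSeq f (ι → R) := by
  intro k m g h
  have := fun i => hf k (m i) (fun j => g j i) (by simpa using congrFun h i)
  choose g' hg' using this
  refine ⟨fun j i => g' i j, ?_⟩
  ext i
  simpa using hg' i

end Koszul

/-! ### Independent linear forms are regular sequences. -/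

section LinearForms

variable {K : Type*} [Field K] {n q : ℕ}

/-- The linear form `∑ vⱼ xⱼ`. -/
noncomputable def linForm : (Fin n → K) →ₗ[K] Poly K n :=
  Fintype.linearCombination K (fun j => (X j : Poly K n))

lemma linForm_apply (v : Fin n → K) : linForm v = ∑ j, v j • (X j : Poly K n) := by
  simp [linForm, Fintype.linearCombination_apply]

lemma linForm_injective : Function.Injective (linForm : (Fin n → K) →ₗ[K] Poly K n) := by
  rw [← LinearMap.ker_eq_bot, LinearMap.ker_eq_bot']
  intro v hv
  ext j
  have := congrArg (coeff (Finsupp.single j 1)) hv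
  simpa [linForm_apply, coeff_sum, coeff_X, Finsupp.single_left_inj] using this

/-- A splitting of K^n modulo the span of the later c_j induces a substitution θ that kills the
later forms, is the identity modulo the ideal they generate, and does not kill the k-th form.
Applying θ to the relation gives θ s = 0 because S is a domain, so s lies in that ideal. -/
theorem isRegularSeq_linForm {c : Fin q → Fin n → K} (hc : LinearIndependent K c) :
    IsRegularSeq (fun k => linForm (c k)) (Poly K n) := by
  intro k s g h
  let L : Submodule K (Fin n → K) := Submodule.span K (c '' (Finset.Ioi k : Set (Fin q)))
  obtain ⟨σ, hσ⟩ := L.mkQ.exists_rightInverse_of_surjective (LinearMap.range_eq_top.mpr L.mkQ_surjective)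
  let T : (Fin n → K) →ₗ[K] (Fin n → K) := σ ∘ₗ L.mkQ
  have hT : ∀ v, T v = 0 ↔ v ∈ L := by
    intro v
    constructor
    · intro hv
      have : L.mkQ (T v) = L.mkQ v := LinearMap.congr_fun hσ (L.mkQ v)
      rw [hv, map_zero] at this
      simpa using this.symm
    · intro hv
      have : L.mkQ v = 0 := by simpa using hv
      simp [T, this]
  have hT' : ∀ v, v - T v ∈ L := by
    intro v
    have : L.mkQ (T v) = L.mkQ v := LinearMap.congr_fun hσ (L.mkQ v)
    rw [← L.ker_mkQ, LinearMap.mem_ker, map_sub, this, sub_self]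
  let I : Ideal (Poly K n) :=
    Ideal.span ((fun j => linForm (c j)) '' (Finset.Ioi k : Set (Fin q)))
  have hLI : ∀ v ∈ L, linForm v ∈ I := by
    intro v hv
    refine Submodule.span_induction ?_ (by simp) ?_ ?_ hv
    · rintro _ ⟨j, hj, rfl⟩
      exact Ideal.subset_span ⟨j, hj, rfl⟩
    · intro x y _ _ hx hy
      rw [map_add]; exact I.add_mem hx hy
    · intro r x _ hx
      rw [map_smul, ← C_mul']; exact I.mul_mem_left _ hx
  let θ : Poly K n →ₐ[K] Poly K n := aeval fun j => linForm (T (Pi.single j 1))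
  have hθ : ∀ v, θ (linForm v) = linForm (T v) := by
    intro v
    have : θ.toLinearMap ∘ₗ linForm = linForm ∘ₗ T := by
      refine (Pi.basisFun K (Fin n)).ext fun j => ?_
      simp [linForm_apply, θ, Pi.single_apply]
    exact LinearMap.congr_fun this v
  have hsub : ∀ s, s - θ s ∈ I := by
    intro s
    have : (Ideal.Quotient.mkₐ K I).comp θ = Ideal.Quotient.mkₐ K I := by
      ext j
      have hX : (X j : Poly K n) = linForm (Pi.single j 1) := by
        simp [linForm_apply, Pi.single_apply]
      simp only [AlgHom.comp_apply, Ideal.Quotient.mkₐ_eq_mk]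
      rw [hX, hθ, eq_comm, Ideal.Quotient.eq, ← map_sub]
      exact hLI _ (hT' _)
    have h := AlgHom.congr_fun this s
    simp only [AlgHom.comp_apply, Ideal.Quotient.mkₐ_eq_mk] at h
    rwa [eq_comm, Ideal.Quotient.eq] at h
  have hz : θ s = 0 := by
    have h1 := congrArg θ h
    simp only [smul_eq_mul, map_mul, map_sum, hθ] at h1
    rw [Finset.sum_eq_zero] at h1
    · refine (mul_eq_zero.mp h1).resolve_left fun h0 => ?_
      have h2 : T (c k) = 0 := linForm_injective (by simpa using h0)
      rw [hT] at h2
      exact hc.notMem_span_image (s := (Finset.Ioi k : Set (Fin q))) (by simp) h2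
    · intro j hj
      rw [(hT (c j)).mpr (Submodule.subset_span ⟨j, by simpa using hj, rfl⟩)]
      simp
  have hs : s ∈ I := by simpa [hz] using hsub s
  obtain ⟨g', hg'⟩ := (Submodule.mem_span_image_finset_iff_exists_fun _).mp hs
  refine ⟨fun j => if h : j ∈ Finset.Ioi k then g' ⟨j, h⟩ else 0, ?_⟩
  rw [← hg', ← Finset.sum_coe_sort (Finset.Ioi k)]
  refine Finset.sum_congr rfl fun j _ => ?_
  dsimp only
  rw [dif_pos j.2, smul_eq_mul, smul_eq_mul, mul_comm]

theorem isRegularSeq_X : IsRegularSeq (fun k => (X k : Poly K n)) (Poly K n) := by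
  have := isRegularSeq_linForm (Pi.basisFun K (Fin n)).linearIndependent
  convert this using 2 with k
  simp [linForm_apply, Pi.single_apply]

end LinearForms

/-! ### Zigzags in a double complex. -/

section DoubleComplex

variable {C : ℕ → ℕ → Type*} [∀ a b, AddCommGroup (C a b)]
  (dh : ∀ a b, C (a + 1) b →+ C a b) (dv : ∀ a b, C a (b + 1) →+ C a b)

/-- A family `c` whose entries on the antidiagonal `a + b = i` form a cycle (up to signs) of the
total complex of the double complex `C`. -/
def IsZigzag (i : ℕ) (c : ∀ a b, C a b) : Prop :=
  ∀ a b, a + b + 1 = i → dh a b (c (a + 1) b) = dv a b (c a (b + 1))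

variable {dh dv}

lemma IsZigzag.swap {i : ℕ} {c : ∀ a b, C a b} (hc : IsZigzag dh dv i c) :
    IsZigzag (C := fun a b => C b a) (fun a b => dv b a) (fun a b => dh b a) i
      (fun a b => c b a) :=
  fun a b h => (hc b a (by omega)).symm

/-- The next entry w must solve dv w = dh y. It exists by vertical exactness, because dv (dh y) = dh
(dv y) = dh (dh x) = 0. -/
theorem exists_partial_zigzag (hcomm : ∀ a b x, dh a b (dv (a + 1) b x) = dv a b (dh a (b + 1) x))
    (hhh : ∀ a b x, dh a b (dh (a + 1) b x) = 0)
    (hv : ∀ a b x, dv a b x = 0 → ∃ y, dv a (b + 1) y = x)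
    (a b : ℕ) (x : C (a + 1) b) (y : C a (b + 1)) (hxy : dh a b x = dv a b y) :
    ∃ c : ∀ a b, C a b, c (a + 1) b = x ∧ c a (b + 1) = y ∧
      ∀ a' b', a' + b' = a + b → a' ≤ a → dh a' b' (c (a' + 1) b') = dv a' b' (c a' (b' + 1)) := by
  induction a generalizing b with
  | zero =>
    refine ⟨Function.update (Function.update 0 1 (Function.update 0 b x)) 0
      (Function.update 0 (b + 1) y), ?_, ?_, ?_⟩
    · rw [Function.update_of_ne (by simp)]; simp
    · simp
    · intro a' b' h1 h2
      obtain rfl : a' = 0 := by omega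
      obtain rfl : b' = b := by omega
      rw [Function.update_of_ne (by simp)]
      simpa using hxy
  | succ a ih =>
    obtain ⟨w, hw⟩ : ∃ w, dv a (b + 1) w = dh a (b + 1) y :=
      hv a b _ (by rw [← hcomm, ← hxy, hhh])
    obtain ⟨c, hc1, hc2, hc⟩ := ih (b + 1) y w hw.symm
    refine ⟨Function.update c (a + 1 + 1) (Function.update (c (a + 1 + 1)) b x), by simp, ?_, ?_⟩
    · rw [Function.update_of_ne (by omega), hc1]
    · intro a' b' h1 h2
      rw [Function.update_of_ne (show a' ≠ a + 1 + 1 by omega)]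
      rcases Nat.lt_or_eq_of_le h2 with h3 | rfl
      · rw [Function.update_of_ne (show a' + 1 ≠ a + 1 + 1 by omega)]
        exact hc a' b' (by omega) (by omega)
      · obtain rfl : b' = b := by omega
        simp [hc1, hxy]

lemma exists_zigzag_zero (x : C 0 0) : ∃ c : ∀ a b, C a b, c 0 0 = x ∧ IsZigzag dh dv 0 c :=
  ⟨Function.update 0 0 (Function.update 0 0 x), by simp, fun a b h => by omega⟩

theorem exists_zigzag_succ
    (hcomm : ∀ a b x, dh a b (dv (a + 1) b x) = dv a b (dh a (b + 1) x))
    (hhh : ∀ a b x, dh a b (dh (a + 1) b x) = 0)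
    (hv : ∀ a b x, dv a b x = 0 → ∃ y, dv a (b + 1) y = x) (j : ℕ) (x : C (j + 1) 0)
    (hx : ∃ y, dv j 0 y = dh j 0 x) :
    ∃ c : ∀ a b, C a b, c (j + 1) 0 = x ∧ IsZigzag dh dv (j + 1) c := by
  obtain ⟨y, hy⟩ := hx
  obtain ⟨c, hc, -, hc'⟩ := exists_partial_zigzag hcomm hhh hv j 0 x y hy.symm
  exact ⟨c, hc, fun a b h => hc' a b (by omega) (by omega)⟩

/-- Descending from the A-edge, every entry of the zigzag is a sum of a horizontal and a vertical
boundary, the vertical part at one entry being the horizontal part at the next. At the B-edge η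
kills the horizontal part. Exchanging the two directions gives the converse comparison. -/
theorem zigzag_boundary {A B : ℕ → Type*} [∀ a, AddCommGroup (A a)] [∀ b, AddCommGroup (B b)]
    {dA : ∀ a, A (a + 1) →+ A a} {dB : ∀ b, B (b + 1) →+ B b}
    {ε : ∀ a, C a 0 →+ A a} {η : ∀ b, C 0 b →+ B b}
    (hcomm : ∀ a b x, dh a b (dv (a + 1) b x) = dv a b (dh a (b + 1) x))
    (hhh : ∀ a b x, dh a b (dh (a + 1) b x) = 0)
    (hv : ∀ a b x, dv a b x = 0 → ∃ y, dv a (b + 1) y = x)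
    (hε : ∀ a x, ε a x = 0 → ∃ y, dv a 0 y = x) (hεs : ∀ a, Function.Surjective (ε a))
    (hεd : ∀ a x, ε a (dh a 0 x) = dA a (ε (a + 1) x))
    (hηh : ∀ b x, η b (dh 0 b x) = 0) (hηd : ∀ b x, η b (dv 0 b x) = dB b (η (b + 1) x))
    {i : ℕ} {c : ∀ a b, C a b} (hc : IsZigzag dh dv i c) (hcA : ∃ α, dA i α = ε i (c i 0)) :
    ∃ β, dB i β = η i (c 0 i) := by
  have key : ∀ b a, a + b = i → ∃ y z, c a b = dh a b y + dv a b z := by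
    intro b
    induction b with
    | zero =>
      intro a h
      obtain rfl : a = i := by omega
      obtain ⟨α, hα⟩ := hcA
      obtain ⟨y, rfl⟩ := hεs _ α
      obtain ⟨z, hz⟩ := hε _ (c a 0 - dh a 0 y) (by rw [map_sub, hεd, hα, sub_self])
      exact ⟨y, z, by rw [hz]; simp⟩
    | succ b ih =>
      intro a h
      obtain ⟨y, z, hyz⟩ := ih (a + 1) (by omega)
      have h1 := hc a b (by omega)
      rw [hyz, map_add, hhh, zero_add, hcomm] at h1
      obtain ⟨w, hw⟩ := hv a b (c a (b + 1) - dh a (b + 1) z) (by rw [map_sub, h1, sub_self])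
      exact ⟨z, w, by rw [hw]; simp⟩
  obtain ⟨y, z, h⟩ := key i 0 (by omega)
  exact ⟨η (i + 1) z, by rw [h, map_add, hηh, zero_add, hηd]⟩

end DoubleComplex

/-! ### Homogeneous components and the initial degree. -/

section Gradings

variable {K : Type*} [Field K] {n r : ℕ}

lemma mem_freeGrading {deg : Fin r → ℤ} {e : ℤ} {f : Fin r → Poly K n} :
    f ∈ freeGrading K n deg e ↔ ∀ a, f a ∈ stdGrading K n (e - deg a) := by
  simp only [freeGrading, Submodule.mem_pi, Set.mem_univ, true_imp_iff]

variable (K n) in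
/-- The projection of a graded free module onto its component of degree `e`. -/
noncomputable def freeProj (deg : Fin r → ℤ) (e : ℤ) :
    (Fin r → Poly K n) →ₗ[K] (Fin r → Poly K n) :=
  LinearMap.pi fun a =>
    weightedHomogeneousComponent (fun _ : Fin n => (1 : ℤ)) (e - deg a) ∘ₗ LinearMap.proj a

lemma freeProj_apply (deg : Fin r → ℤ) (e : ℤ) (f : Fin r → Poly K n) (a : Fin r) :
    freeProj K n deg e f a =
      weightedHomogeneousComponent (fun _ : Fin n => (1 : ℤ)) (e - deg a) (f a) := rfl

lemma freeProj_mem (deg : Fin r → ℤ) (e : ℤ) (f : Fin r → Poly K n) :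
    freeProj K n deg e f ∈ freeGrading K n deg e :=
  mem_freeGrading.mpr fun _ => weightedHomogeneousComponent_mem _ _ _

lemma freeProj_of_mem {deg : Fin r → ℤ} {e : ℤ} {f : Fin r → Poly K n}
    (hf : f ∈ freeGrading K n deg e) : freeProj K n deg e f = f := by
  ext1 a
  rw [freeProj_apply, weightedHomogeneousComponent_of_mem (mem_freeGrading.mp hf a), if_pos rfl]

lemma freeProj_of_mem_ne {deg : Fin r → ℤ} {e e' : ℤ} {f : Fin r → Poly K n}
    (hf : f ∈ freeGrading K n deg e') (h : e ≠ e') : freeProj K n deg e f = 0 := by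
  ext1 a
  rw [freeProj_apply, weightedHomogeneousComponent_of_mem (mem_freeGrading.mp hf a),
    if_neg (by omega)]
  rfl

lemma freeGrading_hom_ext {B : Type*} [AddCommGroup B] [Module K B] (deg : Fin r → ℤ)
    {φ ψ : (Fin r → Poly K n) →ₗ[K] B}
    (h : ∀ e, ∀ f ∈ freeGrading K n deg e, φ f = ψ f) : φ = ψ := by
  refine LinearMap.pi_ext' fun a => (basisMonomials (Fin n) K).ext fun m => ?_
  refine h (Finsupp.weight (fun _ : Fin n => (1 : ℤ)) m + deg a) _ (mem_freeGrading.mpr fun b => ?_)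
  simp only [coe_basisMonomials, LinearMap.coe_single]
  by_cases hb : b = a
  · subst hb
    rw [Pi.single_eq_same]
    exact isWeightedHomogeneous_monomial _ _ _ (by ring)
  · rw [Pi.single_eq_of_ne hb]
    exact Submodule.zero_mem _

/-- The projections `Q` on the target are left abstract so that one argument serves multiplication
by a variable, the differentials and the augmentation. -/
lemma freeProj_intertwine {B : Type*} [AddCommGroup B] [Module K B] (deg : Fin r → ℤ)
    {ℬ : ℤ → Submodule K B} {Q : ℤ → B →ₗ[K] B} (hQ : ∀ e, ∀ y ∈ ℬ e, Q e y = y)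
    (hQ' : ∀ e e', ∀ y ∈ ℬ e', e ≠ e' → Q e y = 0) (s : ℤ) (φ : (Fin r → Poly K n) →ₗ[K] B)
    (hφ : ∀ e, ∀ f ∈ freeGrading K n deg e, φ f ∈ ℬ (e + s)) (e : ℤ) (f : Fin r → Poly K n) :
    Q (e + s) (φ f) = φ (freeProj K n deg e f) := by
  refine LinearMap.congr_fun (f := Q (e + s) ∘ₗ φ) (g := φ ∘ₗ freeProj K n deg e)
    (freeGrading_hom_ext deg fun e' f hf => ?_) f
  simp only [LinearMap.comp_apply]
  by_cases h : e = e'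
  · subst h
    rw [hQ _ _ (hφ _ _ hf), freeProj_of_mem hf]
  · rw [hQ' _ _ _ (hφ _ _ hf) (by omega), freeProj_of_mem_ne hf h, map_zero]

lemma X_mem_stdGrading (j : Fin n) : (X j : Poly K n) ∈ stdGrading K n 1 :=
  isWeightedHomogeneous_X K _ j

lemma freeProj_X_smul (deg : Fin r → ℤ) (e : ℤ) (j : Fin n) (f : Fin r → Poly K n) :
    freeProj K n deg (e + 1) ((X j : Poly K n) • f) =
      (X j : Poly K n) • freeProj K n deg e f := by
  refine freeProj_intertwine deg (fun e y hy => freeProj_of_mem hy)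
    (fun e e' y hy h => freeProj_of_mem_ne hy h) 1
    ((LinearMap.lsmul (Poly K n) (Fin r → Poly K n) (X j)).restrictScalars K) ?_ e f
  intro e f hf
  refine mem_freeGrading.mpr fun a => ?_
  have := (X_mem_stdGrading (K := K) j).mul (mem_freeGrading.mp hf a)
  rw [show e + 1 - deg a = 1 + (e - deg a) by ring]
  exact this

lemma freeProj_d {M : Type*} [AddCommGroup M] [Module K M] [Module (Poly K n) M]
    {ℳ : ℤ → Submodule K M} (G : GradedFreeResolution (n := n) ℳ) (i : ℕ) (e : ℤ)
    (f : Fin (G.rank (i + 1)) → Poly K n) :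
    freeProj K n (G.deg i) e (G.d i f) = G.d i (freeProj K n (G.deg (i + 1)) e f) := by
  have := freeProj_intertwine (G.deg (i + 1)) (fun e y hy => freeProj_of_mem hy)
    (fun e e' y hy h => freeProj_of_mem_ne hy h) 0 ((G.d i).restrictScalars K)
    (fun e f hf => by rw [add_zero]; exact G.d_mem i e f hf) e f
  rwa [add_zero] at this

variable {M : Type*} [AddCommGroup M] [Module K M] (ℳ : ℤ → Submodule K M)
  [DirectSum.Decomposition ℳ]

/-- The projection of a graded module onto its component of degree `e`. -/
def gradedProj (e : ℤ) : M →ₗ[K] M :=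
  (ℳ e).subtype ∘ₗ DirectSum.component K ℤ (fun i => ℳ i) e ∘ₗ
    (DirectSum.decomposeLinearEquiv ℳ).toLinearMap

lemma gradedProj_mem (e : ℤ) (m : M) : gradedProj ℳ e m ∈ ℳ e :=
  (DirectSum.decompose ℳ m e).2

variable {ℳ}

lemma gradedProj_of_mem {e : ℤ} {m : M} (hm : m ∈ ℳ e) : gradedProj ℳ e m = m :=
  DirectSum.decompose_of_mem_same ℳ hm

lemma gradedProj_of_mem_ne {e e' : ℤ} {m : M} (hm : m ∈ ℳ e') (h : e ≠ e') :
    gradedProj ℳ e m = 0 :=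
  DirectSum.decompose_of_mem_ne ℳ hm h.symm

variable [Module (Poly K n) M]

lemma gradedProj_smul [SetLike.GradedSMul (stdGrading K n) ℳ] {x : Poly K n}
    (hx : x ∈ stdGrading K n 1) (e : ℤ) (m : M) :
    gradedProj ℳ (e + 1) (x • m) = x • gradedProj ℳ e m := by
  induction m using DirectSum.Decomposition.inductionOn ℳ with
  | zero => simp
  | add m m' h h' => rw [smul_add, map_add, h, h', map_add, smul_add]
  | @homogeneous i m =>
    have hm : x • (m : M) ∈ ℳ (1 + i) := SetLike.GradedSMul.smul_mem hx m.2
    by_cases h : e = i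
    · subst h
      rw [gradedProj_of_mem (by rwa [add_comm]), gradedProj_of_mem m.2]
    · rw [gradedProj_of_mem_ne hm (by omega), gradedProj_of_mem_ne m.2 h, smul_zero]

variable [IsScalarTower K (Poly K n) M]

lemma gradedProj_aug (G : GradedFreeResolution (n := n) ℳ) (e : ℤ)
    (f : Fin (G.rank 0) → Poly K n) :
    gradedProj ℳ e (G.aug f) = G.aug (freeProj K n (G.deg 0) e f) := by
  have := freeProj_intertwine (G.deg 0) (fun e y hy => gradedProj_of_mem (ℳ := ℳ) hy)
    (fun e e' y hy h => gradedProj_of_mem_ne hy h) 0 (G.aug.restrictScalars K)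
    (fun e f hf => by rw [add_zero]; exact G.aug_mem e f hf) e f
  rwa [add_zero] at this

/-- The degrees of the generators of the first free module bound the degrees of M from below.
Without this, `sInf` in ℤ carries no information. -/
lemma bddBelow_degrees (G : GradedFreeResolution (n := n) ℳ) :
    BddBelow {d : ℤ | ℳ d ≠ ⊥} := by
  obtain ⟨B, hB⟩ := (Set.finite_range (G.deg 0)).bddBelow
  refine ⟨B, fun e he => ?_⟩
  by_contra hlt
  refine he ((Submodule.eq_bot_iff _).mpr fun m hm => ?_)
  obtain ⟨f, rfl⟩ := G.aug_surjective m
  rw [← gradedProj_of_mem hm, gradedProj_aug]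
  have : freeProj K n (G.deg 0) e f = 0 := by
    ext a m
    rw [freeProj_apply, coeff_weightedHomogeneousComponent, if_neg]
    · simp
    · have h1 := hB ⟨a, rfl⟩
      have h2 : 0 ≤ Finsupp.weight (fun _ : Fin n => (1 : ℤ)) m := by
        rw [Finsupp.weight_apply]
        exact Finsupp.sum_nonneg fun i _ => by simp
      omega
  rw [this, map_zero]

lemma eq_bot_of_lt_initialDegree (G : GradedFreeResolution (n := n) ℳ) {e : ℤ}
    (he : e < initialDegree ℳ) : ℳ e = ⊥ := by
  by_contra h
  exact absurd (csInf_le (bddBelow_degrees G) h) (not_le.mpr he)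

/-- Elements of initial degree of `M` which are linear combinations of elements of `M` with
coefficients of degree one vanish. -/
lemma eq_zero_of_initialDegree [SetLike.GradedSMul (stdGrading K n) ℳ]
    (G : GradedFreeResolution (n := n) ℳ) {ι : Type*} (s : Finset ι) (x : ι → Poly K n)
    (hx : ∀ j, x j ∈ stdGrading K n 1) (m : ι → M)
    (h : ∑ j ∈ s, x j • m j ∈ ℳ (initialDegree ℳ)) : ∑ j ∈ s, x j • m j = 0 := by
  rw [← gradedProj_of_mem h, map_sum]
  refine Finset.sum_eq_zero fun j _ => ?_
  have := gradedProj_smul (ℳ := ℳ) (hx j) (initialDegree ℳ - 1) (m j)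
  rw [sub_add_cancel] at this
  rw [this]
  have h0 : gradedProj ℳ (initialDegree ℳ - 1) (m j) ∈ (⊥ : Submodule K M) := by
    rw [← eq_bot_of_lt_initialDegree G (show initialDegree ℳ - 1 < _ by omega)]
    exact gradedProj_mem _ _ _
  rw [(Submodule.mem_bot K).mp h0, smul_zero]

end Gradings

/-! ### Tensoring with the residue field. -/

section Tensor

variable {K : Type*} [Field K] {n : ℕ} {F : Type*} [AddCommGroup F] [Module (Poly K n) F]

lemma tmul_one_eq_zero_iff (f : F) :
    f ⊗ₜ[Poly K n] (1 : ResField K n) = 0 ↔ ∃ g : Fin n → F, f = ∑ j, (X j : Poly K n) • g j := by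
  have h1 : f ⊗ₜ[Poly K n] (1 : ResField K n) = 0 ↔ f ∈ maxIdeal K n • (⊤ : Submodule (Poly K n) F) := by
    rw [← (TensorProduct.tensorQuotEquivQuotSMul F (maxIdeal K n)).map_eq_zero_iff,
      ← map_one (Ideal.Quotient.mk (maxIdeal K n)),
      TensorProduct.tensorQuotEquivQuotSMul_tmul_mk, one_smul, Submodule.Quotient.mk_eq_zero]
  rw [h1]
  constructor
  · intro h
    refine Submodule.smul_induction_on h ?_ ?_
    · intro s hs g _
      obtain ⟨c, rfl⟩ := (Submodule.mem_span_range_iff_exists_fun _).mp hs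
      refine ⟨fun j => c j • g, ?_⟩
      rw [Finset.sum_smul]
      exact Finset.sum_congr rfl fun j _ => by rw [smul_eq_mul, mul_comm, mul_smul]
    · rintro _ _ ⟨g, rfl⟩ ⟨g', rfl⟩
      exact ⟨fun j => g j + g' j, by simp [Finset.sum_add_distrib]⟩
  · rintro ⟨g, rfl⟩
    exact Submodule.sum_mem _ fun j _ =>
      Submodule.smul_mem_smul (Ideal.subset_span ⟨j, rfl⟩) trivial

lemma exists_tmul_one_eq (t : F ⊗[Poly K n] ResField K n) :
    ∃ f : F, f ⊗ₜ[Poly K n] (1 : ResField K n) = t := by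
  induction t with
  | zero => exact ⟨0, by simp⟩
  | add x y hx hy =>
    obtain ⟨f, rfl⟩ := hx
    obtain ⟨g, rfl⟩ := hy
    exact ⟨f + g, TensorProduct.add_tmul _ _ _⟩
  | tmul f y =>
    obtain ⟨s, rfl⟩ := Ideal.Quotient.mk_surjective y
    refine ⟨s • f, ?_⟩
    rw [TensorProduct.smul_tmul, ← map_one (Ideal.Quotient.mk (maxIdeal K n)),
      ← Ideal.Quotient.mk_eq_mk, ← Ideal.Quotient.mk_eq_mk, ← Submodule.Quotient.mk_smul,
      smul_eq_mul, mul_one]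

end Tensor

/-! ### Lifting alternating maps along linear maps. -/

section Postcomp

variable {K : Type*} [Field K] {V A B : Type*} [AddCommGroup V] [Module K V] [AddCommGroup A]
  [Module K A] [AddCommGroup B] [Module K B] {ι : Type*}

lemma exists_pseudoinverse (φ : A →ₗ[K] B) : ∃ s : B →ₗ[K] A, ∀ x, φ (s (φ x)) = φ x := by
  obtain ⟨s, hs⟩ := φ.rangeRestrict.exists_rightInverse_of_surjective φ.range_rangeRestrict
  obtain ⟨t, ht⟩ := (LinearMap.range φ).subtype.exists_leftInverse_of_injective (Submodule.ker_subtype _)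
  refine ⟨s ∘ₗ t, fun x => ?_⟩
  have h1 : t (φ x) = φ.rangeRestrict x := LinearMap.congr_fun ht (φ.rangeRestrict x)
  have h2 := LinearMap.congr_fun hs (φ.rangeRestrict x)
  simp only [LinearMap.comp_apply, h1]
  exact congrArg Subtype.val h2

/-- Over a field φ has a linear section on its range, and composing with it keeps the lift
alternating. Exactness of a resolution thus passes to the columns of the double complex. -/
lemma exists_compAlternatingMap_eq (φ : A →ₗ[K] B) (z : V [⋀^ι]→ₗ[K] B)
    (hz : ∀ v, z v ∈ LinearMap.range φ) :
    ∃ y : V [⋀^ι]→ₗ[K] A, φ.compAlternatingMap y = z := by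
  obtain ⟨s, hs⟩ := exists_pseudoinverse φ
  refine ⟨s.compAlternatingMap z, ?_⟩
  ext v
  obtain ⟨x, hx⟩ := hz v
  simp [← hx, hs]

end Postcomp

/-! ### Koszul cycles, with the relation in every slot. -/

section Cycles

variable {K R : Type*} [Field K] [CommRing R] {q : ℕ}
  {M : Type*} [AddCommGroup M] [Module K M] [Module R M]
  {ι : Type*} [DecidableEq ι]

/-- The alternating map `z` is a cycle of the Koszul complex of `f`, stated for all slots. -/
def IsCycle (f : Fin q → R) (z : (Fin q → K) [⋀^ι]→ₗ[K] M) : Prop :=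
  ∀ (s : ι) (w : ι → Fin q → K), ∑ j, f j • z (Function.update w s (Pi.single j 1)) = 0

lemma isCycle_of_isEmpty [IsEmpty ι] (f : Fin q → R) (z : (Fin q → K) [⋀^ι]→ₗ[K] M) :
    IsCycle f z := fun s => isEmptyElim s

lemma map_update_eq_sign_smul {V : Type*} [AddCommGroup V] [Module K V] {a : ℕ}
    (z : V [⋀^Fin (a + 1)]→ₗ[K] M) (w : Fin (a + 1) → V) (s : Fin (a + 1)) (x : V) :
    z (Function.update w s x) = Equiv.Perm.sign (Equiv.swap 0 s) •
      z (Matrix.vecCons x (Matrix.vecTail (w ∘ Equiv.swap 0 s))) := by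
  have h1 := z.map_perm (Function.update w s x ∘ Equiv.swap 0 s) (Equiv.swap 0 s)
  have h2 : (Function.update w s x ∘ Equiv.swap 0 s) ∘ Equiv.swap 0 s =
      Function.update w s x := by
    ext1 k; simp
  rw [h2] at h1
  rw [h1]
  congr 2
  ext1 k
  refine Fin.cases ?_ (fun k => ?_) k
  · simp
  · have : Equiv.swap 0 s k.succ ≠ s := by
      intro h
      have := (Equiv.swap 0 s).injective (h.trans (Equiv.swap_apply_left 0 s).symm)
      exact Fin.succ_ne_zero k this
    simp [Function.update_of_ne this, Matrix.vecTail]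

/-- A transposition moves any slot to the front at the cost of a sign. -/
lemma isCycle_iff_koszulD [Algebra K R] [IsScalarTower K R M] {a : ℕ} (f : Fin q → R)
    (z : (Fin q → K) [⋀^Fin (a + 1)]→ₗ[K] M) : IsCycle f z ↔ koszulD f a z = 0 := by
  constructor
  · intro h
    ext v
    rw [koszulD_apply, AlternatingMap.zero_apply, ← h 0 (Matrix.vecCons 0 v)]
    exact Finset.sum_congr rfl fun j _ => by
      rw [Matrix.vecCons, Matrix.vecCons, Fin.update_cons_zero]
  · intro h s w
    simp only [map_update_eq_sign_smul]
    have h3 := DFunLike.congr_fun h (Matrix.vecTail (w ∘ Equiv.swap 0 s))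
    rw [koszulD_apply, AlternatingMap.zero_apply] at h3
    rcases Int.units_eq_one_or (Equiv.Perm.sign (Equiv.swap 0 s)) with h4 | h4 <;>
      simp [h4, h3, Finset.sum_neg_distrib]

end Cycles

/-! ### Comparison of Tor with cycles in the initial degree. -/

section Resolution

variable {K : Type*} [Field K] {n : ℕ} {M : Type*} [AddCommGroup M] [Module K M]
  [Module (Poly K n) M] {ℳ : ℤ → Submodule K M}

/-- Postcomposition of alternating maps with a linear map. -/
def postcomp {A B V ι : Type*} [AddCommGroup V] [Module K V] [AddCommGroup A] [Module K A]
    [AddCommGroup B] [Module K B] (φ : A →ₗ[K] B) :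
    (V [⋀^ι]→ₗ[K] A) →ₗ[K] (V [⋀^ι]→ₗ[K] B) where
  toFun z := φ.compAlternatingMap z
  map_add' z w := by ext; simp
  map_smul' c z := by ext; simp

@[simp]
lemma postcomp_apply {A B V ι : Type*} [AddCommGroup V] [Module K V] [AddCommGroup A] [Module K A]
    [AddCommGroup B] [Module K B] (φ : A →ₗ[K] B) (z : V [⋀^ι]→ₗ[K] A) (v : ι → V) :
    postcomp φ z v = φ (z v) := rfl

namespace GradedFreeResolution

variable (G : GradedFreeResolution (n := n) ℳ)

/-- The terms of the double complex obtained from the Koszul complex and a resolution. -/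
abbrev KC (a b : ℕ) : Type _ := (Fin n → K) [⋀^Fin a]→ₗ[K] (Fin (G.rank b) → Poly K n)

/-- The Koszul differential of the double complex. -/
noncomputable def dh (a b : ℕ) : G.KC (a + 1) b →+ G.KC a b :=
  (koszulDLin K (Fin (G.rank b) → Poly K n) (fun j => (X j : Poly K n)) a).toAddMonoidHom

/-- The differential of the double complex induced by the resolution. -/
noncomputable def dv (a b : ℕ) : G.KC a (b + 1) →+ G.KC a b :=
  (postcomp ((G.d b).restrictScalars K)).toAddMonoidHom

/-- The augmentation of the double complex to the resolution tensored with the residue field. -/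
noncomputable def η (b : ℕ) :
    G.KC 0 b →+ (Fin (G.rank b) → Poly K n) ⊗[Poly K n] ResField K n where
  toFun z := z ![] ⊗ₜ 1
  map_zero' := by simp
  map_add' z w := by simp [TensorProduct.add_tmul]

lemma dh_apply (a b : ℕ) (z : G.KC (a + 1) b) :
    G.dh a b z = koszulD (fun j => (X j : Poly K n)) a z := rfl

lemma dv_apply (a b : ℕ) (z : G.KC a (b + 1)) (v : Fin a → Fin n → K) :
    G.dv a b z v = G.d b (z v) := rfl

lemma η_apply (b : ℕ) (z : G.KC 0 b) : G.η b z = z ![] ⊗ₜ 1 := rfl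

lemma aug_d (x : Fin (G.rank 1) → Poly K n) : G.aug (G.d 0 x) = 0 :=
  G.exact_aug.apply_apply_eq_zero x

lemma d_d (i : ℕ) (x : Fin (G.rank (i + 2)) → Poly K n) : G.d i (G.d (i + 1) x) = 0 :=
  (G.exact_d i).apply_apply_eq_zero x

lemma dh_dv (a b : ℕ) (x : G.KC (a + 1) (b + 1)) :
    G.dh a b (G.dv (a + 1) b x) = G.dv a b (G.dh a (b + 1) x) :=
  koszulD_compAlternatingMap _ _ (fun _ _ => (G.d b).map_smul _ _) x

lemma dh_dh (a b : ℕ) (x : G.KC (a + 2) b) : G.dh a b (G.dh (a + 1) b x) = 0 :=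
  koszulD_koszulD _ x

lemma dv_dv (a b : ℕ) (x : G.KC a (b + 2)) : G.dv a b (G.dv a (b + 1) x) = 0 := by
  ext1 v
  exact G.d_d b _

lemma exists_dv_eq (a b : ℕ) (x : G.KC a (b + 1)) (hx : G.dv a b x = 0) :
    ∃ y, G.dv a (b + 1) y = x :=
  exists_compAlternatingMap_eq ((G.d (b + 1)).restrictScalars K) x fun v =>
    (G.exact_d b (x v)).mp (DFunLike.congr_fun hx v)

lemma exists_dh_eq (a b : ℕ) (x : G.KC (a + 1) b) (hx : G.dh a b x = 0) :
    ∃ y, G.dh (a + 1) b y = x :=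
  exists_koszulD_eq (isRegularSeq_X.pi _) x hx

lemma η_surjective (b : ℕ) : Function.Surjective (G.η b) := fun t => by
  obtain ⟨f, rfl⟩ := exists_tmul_one_eq t
  exact ⟨AlternatingMap.constOfIsEmpty K (Fin n → K) (Fin 0) f, rfl⟩

lemma η_dh (b : ℕ) (x : G.KC 1 b) : G.η b (G.dh 0 b x) = 0 := by
  rw [η_apply, tmul_one_eq_zero_iff]
  exact ⟨_, koszulD_apply _ _ _⟩

lemma exists_dh_eq_of_η (b : ℕ) (x : G.KC 0 b) (hx : G.η b x = 0) : ∃ y, G.dh 0 b y = x := by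
  rw [η_apply, tmul_one_eq_zero_iff] at hx
  obtain ⟨g, hg⟩ := hx
  refine ⟨∑ j, wedge (LinearMap.proj j)
    (AlternatingMap.constOfIsEmpty K (Fin n → K) (Fin 0) (g j)), ?_⟩
  rw [map_sum]
  simp only [dh_apply, koszulD_wedge_zero]
  ext1 v
  rw [Subsingleton.elim v ![], hg]
  simp [alternatingMap_sum_apply]

lemma η_dv (b : ℕ) (x : G.KC 0 (b + 1)) :
    G.η b (G.dv 0 b x) = (G.tensorD b).toAddMonoidHom (G.η (b + 1) x) := rfl

/-- The homogeneous part of degree `t` of a family of elements of the double complex. -/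
noncomputable def homogPart (t : ℤ) (c : ∀ a b, G.KC a b) (a b : ℕ) : G.KC a b :=
  postcomp (freeProj K n (G.deg b) (t - a)) (c a b)

lemma isZigzag_homogPart (t : ℤ) {i : ℕ} {c : ∀ a b, G.KC a b}
    (hc : IsZigzag G.dh G.dv i c) : IsZigzag G.dh G.dv i (G.homogPart t c) := by
  intro a b hab
  ext1 v
  have h := congrArg (freeProj K n (G.deg b) (t - a)) (DFunLike.congr_fun (hc a b hab) v)
  rw [dv_apply, freeProj_d] at h
  rw [dv_apply]
  simp only [homogPart, postcomp_apply]
  rw [← h, dh_apply, dh_apply, koszulD_apply, koszulD_apply, map_sum]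
  refine Finset.sum_congr rfl fun j _ => ?_
  -- The factor x_j raises the coefficient degree by one, exactly compensating the drop of the
  -- Koszul degree from a+1 to a.
  rw [show t - (a : ℤ) = t - ((a + 1 : ℕ) : ℤ) + 1 by push_cast; ring, freeProj_X_smul]
  rfl

variable [IsScalarTower K (Poly K n) M]

/-- The augmentation of the double complex to the Koszul complex of `M`. -/
noncomputable def ε (a : ℕ) : G.KC a 0 →+ ((Fin n → K) [⋀^Fin a]→ₗ[K] M) :=
  (postcomp (G.aug.restrictScalars K)).toAddMonoidHom

lemma ε_apply (a : ℕ) (z : G.KC a 0) (v : Fin a → Fin n → K) : G.ε a z v = G.aug (z v) := rfl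

lemma exists_dv_eq_of_ε (a : ℕ) (x : G.KC a 0) (hx : G.ε a x = 0) : ∃ y, G.dv a 0 y = x :=
  exists_compAlternatingMap_eq ((G.d 0).restrictScalars K) x fun v =>
    (G.exact_aug (x v)).mp (DFunLike.congr_fun hx v)

lemma ε_surjective (a : ℕ) : Function.Surjective (G.ε a) := fun z =>
  exists_compAlternatingMap_eq (G.aug.restrictScalars K) z fun v => G.aug_surjective (z v)

lemma ε_dh (a : ℕ) (x : G.KC (a + 1) 0) :
    G.ε a (G.dh a 0 x) = (koszulDLin K M (fun j => (X j : Poly K n)) a).toAddMonoidHom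
      (G.ε (a + 1) x) :=
  (koszulD_compAlternatingMap _ _ (fun _ _ => G.aug.map_smul _ _) x).symm

lemma ε_dv (a : ℕ) (x : G.KC a 1) : G.ε a (G.dv a 0 x) = 0 := by
  ext1 v
  exact G.aug_d _

end GradedFreeResolution

variable [IsScalarTower K (Poly K n) M]

variable (n ℳ) in
/-- The linear strand: cycles of the Koszul complex of `M` with coefficients of initial degree. -/
noncomputable def linearCycles (i : ℕ) : Submodule K ((Fin n → K) [⋀^Fin i]→ₗ[K] M) where
  carrier := {z | (∀ v, z v ∈ ℳ (initialDegree ℳ)) ∧ IsCycle (fun j => (X j : Poly K n)) z}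
  zero_mem' := ⟨fun v => Submodule.zero_mem _, fun s w => by simp⟩
  add_mem' {z w} hz hw := ⟨fun v => Submodule.add_mem _ (hz.1 v) (hw.1 v), fun s v => by
    simp [Finset.sum_add_distrib, hz.2 s v, hw.2 s v]⟩
  smul_mem' c z hz := ⟨fun v => Submodule.smul_mem _ c (hz.1 v), fun s v => by
    have := congrArg (c • ·) (hz.2 s v)
    simp only [Finset.smul_sum, smul_zero] at this
    rw [← this]
    exact Finset.sum_congr rfl fun j _ => smul_comm _ _ _⟩

namespace GradedFreeResolution

variable (G : GradedFreeResolution (n := n) ℳ)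

/-- A representative of the class is joined by a homogeneous zigzag to an element over M. If that
element were zero, `zigzag_boundary` would make the representative a boundary. -/
theorem exists_linearCycle_ne_zero (i : ℕ) (h : G.tor i (i + initialDegree ℳ) ≠ ⊥) :
    ∃ z ∈ linearCycles n ℳ i, z ≠ 0 := by
  obtain ⟨t, ht, ht0⟩ := Submodule.exists_mem_ne_zero_of_ne_bot h
  obtain ⟨y, ⟨hy, f, hf, rfl⟩, rfl⟩ := ht
  have hf' : f ⊗ₜ[Poly K n] (1 : ResField K n) ∉ G.torBoundaries i := fun h =>
    ht0 ((Submodule.Quotient.mk_eq_zero _).mpr h)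
  let x : G.KC 0 i := AlternatingMap.constOfIsEmpty K (Fin n → K) (Fin 0) f
  obtain ⟨c, hcx, hc⟩ : ∃ c : ∀ a b, G.KC a b, c 0 i = x ∧ IsZigzag G.dh G.dv i c := by
    cases i with
    | zero =>
      obtain ⟨c, h1, h2⟩ := exists_zigzag_zero (dh := G.dh) (dv := G.dv) x
      exact ⟨c, h1, h2⟩
    | succ j =>
      obtain ⟨c, h1, h2⟩ := exists_zigzag_succ (C := fun a b => G.KC b a)
        (dh := fun a b => G.dv b a) (dv := fun a b => G.dh b a)
        (fun a b x => (G.dh_dv b a x).symm) (fun a b x => G.dv_dv b a x)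
        (fun a b x => G.exists_dh_eq b a x) j x
        (G.exists_dh_eq_of_η j _ (by rw [η_dv]; exact hy))
      exact ⟨fun a b => c b a, h1, h2.swap⟩
  let c' := G.homogPart (i + initialDegree ℳ) c
  have hc' : IsZigzag G.dh G.dv i c' := G.isZigzag_homogPart _ hc
  have hcx' : c' 0 i ![] = f := by
    simp only [c', homogPart, postcomp_apply, hcx, Nat.cast_zero, sub_zero]
    exact freeProj_of_mem hf
  refine ⟨G.ε i (c' i 0), ⟨fun v => ?_, ?_⟩, fun h0 => hf' ?_⟩
  · rw [ε_apply]
    refine G.aug_mem _ _ ?_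
    have := freeProj_mem (K := K) (n := n) (G.deg 0) (i + initialDegree ℳ - i) (c i 0 v)
    rw [show (i : ℤ) + initialDegree ℳ - i = initialDegree ℳ by ring] at this
    simp only [c', homogPart, postcomp_apply]
    rwa [show (i : ℤ) + initialDegree ℳ - i = initialDegree ℳ by ring]
  · cases i with
    | zero => exact isCycle_of_isEmpty _ _
    | succ a =>
      rw [isCycle_iff_koszulD]
      have := G.ε_dh a (c' (a + 1) 0)
      rw [hc' a 0 (by omega), ε_dv] at this
      exact this.symm
  · obtain ⟨β, hβ⟩ := zigzag_boundary (dh := G.dh) (dv := G.dv) (ε := G.ε) (η := G.η)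
      (dB := fun b => (G.tensorD b).toAddMonoidHom)
      G.dh_dv G.dh_dh G.exists_dv_eq G.exists_dv_eq_of_ε G.ε_surjective G.ε_dh G.η_dh G.η_dv hc'
      ⟨0, by rw [h0, map_zero]⟩
    rw [η_apply, hcx'] at hβ
    exact ⟨β, hβ⟩

variable [DirectSum.Decomposition ℳ]

lemma exists_zigzag_of_linearCycle {i : ℕ} {z : (Fin n → K) [⋀^Fin i]→ₗ[K] M}
    (hz : z ∈ linearCycles n ℳ i) :
    ∃ c : ∀ a b, G.KC a b, IsZigzag G.dh G.dv i c ∧ G.ε i (c i 0) = z ∧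
      c 0 i ![] ∈ freeGrading K n (G.deg i) (i + initialDegree ℳ) := by
  obtain ⟨x, hx⟩ := G.ε_surjective i z
  obtain ⟨c, hcx, hc⟩ : ∃ c : ∀ a b, G.KC a b, c i 0 = x ∧ IsZigzag G.dh G.dv i c := by
    cases i with
    | zero => exact exists_zigzag_zero (dh := G.dh) (dv := G.dv) x
    | succ j =>
      refine exists_zigzag_succ G.dh_dv G.dh_dh G.exists_dv_eq j x
        (G.exists_dv_eq_of_ε j _ ?_)
      rw [ε_dh, hx]
      exact (isCycle_iff_koszulD _ z).mp hz.2
  refine ⟨G.homogPart (i + initialDegree ℳ) c, G.isZigzag_homogPart _ hc, ?_, ?_⟩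
  · ext1 v
    rw [ε_apply, homogPart, postcomp_apply, ← gradedProj_aug, hcx, ← ε_apply, hx]
    refine gradedProj_of_mem ?_
    rw [show (i : ℤ) + initialDegree ℳ - i = initialDegree ℳ by ring]
    exact hz.1 v
  · have := freeProj_mem (K := K) (n := n) (G.deg i) (i + initialDegree ℳ - (0 : ℕ)) (c 0 i ![])
    rw [Nat.cast_zero, sub_zero] at this
    simp only [homogPart, postcomp_apply]
    rwa [Nat.cast_zero, sub_zero]

/-- Vectors of constants represent everything modulo the variables. Finiteness guarantees that
`Module.finrank` of Tor is not its default value 0. -/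
instance finite_tensor (r : ℕ) :
    Module.Finite K ((Fin r → Poly K n) ⊗[Poly K n] ResField K n) := by
  let φ : (Fin r → K) →ₗ[K] (Fin r → Poly K n) ⊗[Poly K n] ResField K n :=
    ((TensorProduct.mk (Poly K n) (Fin r → Poly K n) (ResField K n)).flip 1).restrictScalars K ∘ₗ
      (Algebra.linearMap K (Poly K n)).compLeft (Fin r)
  refine Module.Finite.of_surjective φ fun t => ?_
  obtain ⟨f, rfl⟩ := exists_tmul_one_eq t
  refine ⟨fun a => constantCoeff (f a), ?_⟩
  have hmem : ∀ p : Poly K n, ∃ g : Fin n → Poly K n,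
      C (constantCoeff p) - p = ∑ j, (X j : Poly K n) • g j := by
    intro p
    have : C (constantCoeff p) - p ∈ maxIdeal K n := by
      rw [maxIdeal, idealOfVars, ← Set.image_univ, mem_ideal_span_X_image]
      intro m hm
      by_contra hcon
      push Not at hcon
      have : m = 0 := Finsupp.ext fun i => hcon i trivial
      subst this
      simp [constantCoeff_eq] at hm
    obtain ⟨c, hc⟩ := (Submodule.mem_span_range_iff_exists_fun _).mp this
    exact ⟨c, by rw [← hc]; exact Finset.sum_congr rfl fun j _ => by simp [mul_comm]⟩
  choose g hg using fun a => hmem (f a)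
  change ((fun a => C (constantCoeff (f a))) : Fin r → Poly K n) ⊗ₜ[Poly K n] (1 : ResField K n) = _
  rw [← sub_eq_zero, ← TensorProduct.sub_tmul, tmul_one_eq_zero_iff]
  refine ⟨fun j a => g a j, ?_⟩
  ext1 a
  simpa using hg a

instance finite_tor (i : ℕ) (j : ℤ) : Module.Finite K (G.tor i j) := by
  have : Module.Finite K (((Fin (G.rank i) → Poly K n) ⊗[Poly K n] ResField K n) ⧸
      G.torBoundaries i) :=
    Module.Finite.of_surjective ((G.torBoundaries i).mkQ.restrictScalars K)
      (G.torBoundaries i).mkQ_surjective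
  infer_instance

variable [SetLike.GradedSMul (stdGrading K n) ℳ]

/-- A relation among the resulting Tor classes is carried back by the same combination of zigzags: Σ
g_s z_s becomes a Koszul boundary with values in the initial degree, hence zero. Independence of the
z_s then forces g = 0. -/
theorem card_le_finrank_tor {ι : Type*} [Fintype ι] {i : ℕ}
    {z : ι → (Fin n → K) [⋀^Fin i]→ₗ[K] M} (hz : ∀ s, z s ∈ linearCycles n ℳ i)
    (hli : LinearIndependent K z) :
    Fintype.card ι ≤ Module.finrank K (G.tor i (i + initialDegree ℳ)) := by
  choose c hc hcz hcf using fun s => G.exists_zigzag_of_linearCycle (hz s)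
  have hcyc : ∀ s, G.η i (c s 0 i) ∈ G.torCycles i := by
    intro s
    cases i with
    | zero => trivial
    | succ j =>
      have := G.η_dv j (c s 0 (j + 1))
      rw [← hc s 0 j (by omega), η_dh] at this
      exact this.symm
  let t : ι → G.tor i (i + initialDegree ℳ) := fun s =>
    ⟨(G.torBoundaries i).mkQ (G.η i (c s 0 i)), G.η i (c s 0 i),
      ⟨hcyc s, c s 0 i ![], hcf s, rfl⟩, rfl⟩
  have ht : LinearIndependent K t := by
    rw [Fintype.linearIndependent_iff] at hli ⊢
    intro g hg
    refine hli g ?_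
    let c' : ∀ a b, G.KC a b := fun a b => ∑ s, g s • c s a b
    have hc' : IsZigzag G.dh G.dv i c' := by
      intro a b hab
      simp only [c', map_sum]
      refine Finset.sum_congr rfl fun s _ => ?_
      have h1 : G.dh a b (g s • c s (a + 1) b) = g s • G.dh a b (c s (a + 1) b) :=
        (koszulDLin K _ _ a).map_smul _ _
      have h2 : G.dv a b (g s • c s a (b + 1)) = g s • G.dv a b (c s a (b + 1)) :=
        (postcomp _).map_smul _ _
      rw [h1, h2, hc s a b hab]
    have hη : G.η i (c' 0 i) = ∑ s, g s • G.η i (c s 0 i) := by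
      simp only [c', map_sum]
      rfl
    have hb : G.η i (c' 0 i) ∈ G.torBoundaries i := by
      rw [← Submodule.Quotient.mk_eq_zero, hη]
      have := congrArg Subtype.val hg
      simp only [t, AddSubmonoidClass.coe_finsetSum, Submodule.coe_smul, ZeroMemClass.coe_zero] at this
      rw [← this]
      exact map_sum ((G.torBoundaries i).mkQ.restrictScalars K) _ _
    obtain ⟨β, hβ⟩ := zigzag_boundary (C := fun a b => G.KC b a)
      (dh := fun a b => G.dv b a) (dv := fun a b => G.dh b a) (ε := G.η) (η := G.ε)
      (dB := fun a => (koszulDLin K M (fun j => (X j : Poly K n)) a).toAddMonoidHom)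
      (dA := fun b => (G.tensorD b).toAddMonoidHom)
      (fun a b x => (G.dh_dv b a x).symm) (fun a b x => G.dv_dv b a x)
      (fun a b x => G.exists_dh_eq b a x) G.exists_dh_eq_of_η G.η_surjective
      G.η_dv G.ε_dv G.ε_dh hc'.swap (by obtain ⟨α, hα⟩ := hb; exact ⟨α, hα⟩)
    have hsum : ∑ s, g s • z s = koszulD (fun j => (X j : Poly K n)) i β := by
      change koszulD (fun j => (X j : Poly K n)) i β = G.ε i (∑ s, g s • c s i 0) at hβ
      rw [hβ, map_sum]
      exact Finset.sum_congr rfl fun s _ => by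
        rw [← hcz s]
        exact ((postcomp (G.aug.restrictScalars K)).map_smul (g s) (c s i 0)).symm
    have hmem : ∑ s, g s • z s ∈ linearCycles n ℳ i :=
      Submodule.sum_mem _ fun s _ => Submodule.smul_mem _ _ (hz s)
    ext1 v
    have h1 := hmem.1 v
    rw [hsum, koszulD_apply] at h1 ⊢
    exact eq_zero_of_initialDegree G _ _ X_mem_stdGrading _ h1
  exact ht.fintype_card_le_finrank

/-- The bound concerns the cardinal rank, since it is also what proves the cycle space
finite-dimensional. -/
theorem rank_linearCycles_le (i : ℕ) :
    Module.rank K (linearCycles n ℳ i) ≤ Module.finrank K (G.tor i (i + initialDegree ℳ)) :=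
  rank_le fun s hs => by
    have := G.card_le_finrank_tor (ι := s) (z := fun x => x.1.1) (fun x => x.1.2)
      (hs.map' (linearCycles n ℳ i).subtype (Submodule.ker_subtype _))
    simpa using this

end GradedFreeResolution

theorem finite_linearCycles_of_linBetti_ne_zero [DirectSum.Decomposition ℳ]
    [SetLike.GradedSMul (stdGrading K n) ℳ] {p : ℕ} (hp : linBetti n ℳ p ≠ 0) :
    (∃ z ∈ linearCycles n ℳ p, z ≠ 0) ∧ Nonempty (GradedFreeResolution (n := n) ℳ) ∧
      ∀ i, Module.Finite K (linearCycles n ℳ i) ∧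
        Module.finrank K (linearCycles n ℳ i) ≤ linBetti n ℳ i := by
  -- Without a resolution the Betti number takes its default value 0, so nonvanishing provides one.
  have h : Nonempty (GradedFreeResolution (n := n) ℳ) := by
    by_contra h
    exact hp (by rw [linBetti, gradedBetti, dif_neg h])
  have hb : ∀ i, linBetti n ℳ i = Module.finrank K (h.some.tor i (i + initialDegree ℳ)) := fun i => by
    rw [linBetti, gradedBetti, dif_pos h]
  refine ⟨h.some.exists_linearCycle_ne_zero p fun h0 => ?_, h, fun i => ?_⟩
  · rw [hb, h0] at hp
    simp at hp
  · have := h.some.rank_linearCycles_le i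
    rw [← hb] at this
    refine ⟨Module.rank_lt_aleph0_iff.mp (this.trans_lt (Cardinal.natCast_lt_aleph0)),
      Module.finrank_le_of_rank_le this⟩

end Resolution

/-! ### Contractions of a cycle and their independence. -/

section Contraction

lemma extend_update {V ι κ : Type*} [DecidableEq ι] [DecidableEq κ] (σ : ι ↪ κ) (w : ι → V)
    (u : κ → V) (k : ι) (x : V) :
    Function.extend σ (Function.update w k x) u =
      Function.update (Function.extend σ w u) (σ k) x := by
  ext1 s
  by_cases hs : ∃ l, σ l = s
  · obtain ⟨l, rfl⟩ := hs
    rw [σ.injective.extend_apply]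
    by_cases h : l = k
    · subst h; simp
    · rw [Function.update_of_ne h, Function.update_of_ne (σ.injective.ne h),
        σ.injective.extend_apply]
  · rw [Function.extend_apply' _ _ _ hs, Function.update_of_ne (fun h => hs ⟨k, h.symm⟩),
      Function.extend_apply' _ _ _ hs]

lemma extend_update_of_notMem {V ι κ : Type*} [DecidableEq κ] (σ : ι ↪ κ) (w : ι → V)
    (u : κ → V) {m : κ} (hm : m ∉ Set.range σ) (x : V) :
    Function.extend σ w (Function.update u m x) =
      Function.update (Function.extend σ w u) m x := by
  ext1 s
  by_cases hs : ∃ l, σ l = s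
  · obtain ⟨l, rfl⟩ := hs
    rw [Function.update_of_ne (fun h => hm ⟨l, h⟩), σ.injective.extend_apply,
      σ.injective.extend_apply]
  · rw [Function.extend_apply' _ _ _ hs]
    by_cases h : s = m
    · subst h; simp
    · rw [Function.update_of_ne h, Function.update_of_ne h, Function.extend_apply' _ _ _ hs]

lemma extend_comp_comp {V ι κ : Type*} (σ : ι ↪ κ) (v : κ → V) (f : ι → κ) :
    Function.extend σ (v ∘ f) v = v ∘ Function.extend σ f id := by
  ext1 s
  by_cases hs : ∃ l, σ l = s
  · obtain ⟨l, rfl⟩ := hs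
    simp [σ.injective.extend_apply]
  · simp [Function.extend_apply' _ _ _ hs]

variable {K : Type*} [Field K] {V M : Type*} [AddCommGroup V] [Module K V] [AddCommGroup M]
  [Module K M] {p i : ℕ}

/-- The alternating map obtained from `z` by fixing the arguments `u s` in the slots `s` outside the
range of `σ`. -/
noncomputable def contract (z : V [⋀^Fin p]→ₗ[K] M) (σ : Fin i ↪ Fin p) (u : Fin p → V) :
    V [⋀^Fin i]→ₗ[K] M where
  toFun w := z (Function.extend σ w u)
  map_update_add' w k x y := by
    classical
    have h := fun x => extend_update σ w u k x
    convert z.map_update_add (Function.extend σ w u) (σ k) x y using 1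
    · rw [← h]
    · rw [← h, ← h]
  map_update_smul' w k c x := by
    classical
    have h := fun x => extend_update σ w u k x
    convert z.map_update_smul (Function.extend σ w u) (σ k) c x using 1
    · rw [← h]
    · rw [← h]
  map_eq_zero_of_eq' w k l hw hkl := z.map_eq_zero_of_eq _
    (by rw [σ.injective.extend_apply, σ.injective.extend_apply, hw]) (σ.injective.ne hkl)

lemma contract_apply (z : V [⋀^Fin p]→ₗ[K] M) (σ : Fin i ↪ Fin p) (u : Fin p → V)
    (w : Fin i → V) : contract z σ u w = z (Function.extend σ w u) := rfl

lemma IsCycle.contract {R : Type*} [CommRing R] [Module R M] {q : ℕ} {f : Fin q → R}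
    {z : (Fin q → K) [⋀^Fin p]→ₗ[K] M} (hz : IsCycle f z) (σ : Fin i ↪ Fin p)
    (u : Fin p → Fin q → K) : IsCycle f (contract z σ u) := fun s w => by
  simp only [contract_apply, extend_update]
  exact hz _ _

lemma contract_mem_linearCycles {n : ℕ} [Module (Poly K n) M] [IsScalarTower K (Poly K n) M]
    {ℳ : ℤ → Submodule K M} {z : (Fin n → K) [⋀^Fin p]→ₗ[K] M} (hz : z ∈ linearCycles n ℳ p)
    (σ : Fin i ↪ Fin p) (u : Fin p → Fin n → K) : contract z σ u ∈ linearCycles n ℳ i :=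
  ⟨fun _ => hz.1 _, hz.2.contract σ u⟩

/-- The subsets of `Fin p` with `i` elements. -/
abbrev Subsets (p i : ℕ) : Type := {I : Finset (Fin p) // I.card = i}

/-- The increasing enumeration of a subset. -/
def enum (I : Subsets p i) : Fin i ↪ Fin p := (I.1.orderEmbOfFin I.2).toEmbedding

lemma range_enum (I : Subsets p i) : Set.range (enum I) = I.1 :=
  Finset.range_orderEmbOfFin _ _

lemma subset_of_injective {κ : Type*} {I J : Finset κ} {h : κ → κ}
    (hinj : Function.Injective h) (hid : ∀ s ∉ I, h s = s) (hJ : ∀ x ∈ J, ∃ s ∈ I, h s = x) :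
    J ⊆ I := by
  intro x hx
  by_contra hxI
  obtain ⟨s, hs, rfl⟩ := hJ x hx
  have := hinj (hid _ hxI)
  exact hxI (by rwa [this])

lemma eq_of_injective_extend {I J : Subsets p i}
    (h : Function.Injective (Function.extend (enum I) (enum J) id)) : I = J := by
  refine Subtype.ext (Finset.eq_of_subset_of_card_le (subset_of_injective h ?_ ?_)
    (by rw [I.2, J.2])).symm
  · intro s hs
    rw [Function.extend_apply']
    · rfl
    · intro hs'
      have : s ∈ Set.range (enum I) := hs'
      rw [range_enum] at this
      exact hs this
  · intro x hx
    have : x ∈ Set.range (enum J) := by rw [range_enum]; exact hx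
    obtain ⟨k, rfl⟩ := this
    refine ⟨enum I k, ?_, (enum I).injective.extend_apply _ _ _⟩
    have : enum I k ∈ Set.range (enum I) := ⟨k, rfl⟩
    rwa [range_enum] at this

lemma extend_self {ι κ : Type*} (σ : ι ↪ κ) : Function.extend σ σ id = id := by
  ext1 s
  by_cases hs : ∃ l, σ l = s
  · obtain ⟨l, rfl⟩ := hs
    simp [σ.injective.extend_apply]
  · simp [Function.extend_apply' _ _ _ hs]

lemma map_comp_eq_zero (z : V [⋀^Fin p]→ₗ[K] M) (v : Fin p → V) {h : Fin p → Fin p}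
    (hh : ¬Function.Injective h) : z (v ∘ h) = 0 := by
  simp only [Function.Injective, not_forall] at hh
  obtain ⟨s, t, hst, hne⟩ := hh
  exact z.map_eq_zero_of_eq _ (by simp [hst]) hne

-- The slots in I receive the v_s with s in J, the others keep their own v_s. For I ≠ J some v_s
-- occurs twice, so the evaluation matrix is diagonal.
open Classical in
lemma contract_enum_apply (z : V [⋀^Fin p]→ₗ[K] M) (v : Fin p → V) (I J : Subsets p i) :
    contract z (enum I) v (v ∘ enum J) = if I = J then z v else 0 := by
  rw [contract_apply, extend_comp_comp]
  split_ifs with h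
  · rw [h, extend_self]; rfl
  · exact map_comp_eq_zero z v fun hinj => h (eq_of_injective_extend hinj)

theorem linearIndependent_contract (z : V [⋀^Fin p]→ₗ[K] M) {v : Fin p → V} (hv : z v ≠ 0) :
    LinearIndependent K fun I : Subsets p i => contract z (enum I) v := by
  classical
  rw [Fintype.linearIndependent_iff]
  intro g hg J
  have := DFunLike.congr_fun hg (v ∘ enum J)
  simp only [alternatingMap_sum_apply, AlternatingMap.smul_apply, contract_enum_apply] at this
  simpa [hv] using this

end Contraction

/-! ### The bound for first syzygies, by partial derivatives. -/

section TorsionFree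

/-- A K-basis of Z already spans the L-span of the image. Hence L-combinations of images may be
counted, which need not themselves be images. -/
lemma card_le_finrank_of_mem_span {K L Z Q : Type*} [Field K] [Field L] [AddCommGroup Z]
    [Module K Z] [Module.Finite K Z] [AddCommGroup Q] [Module L Q] [Module K Q] [SMul K L]
    [IsScalarTower K L Q] (Ψ : Z →ₗ[K] Q) {ι : Type*} [Fintype ι] {y : ι → Q}
    (hy : LinearIndependent L y) (hmem : ∀ t, y t ∈ Submodule.span L (Set.range Ψ)) :
    Fintype.card ι ≤ Module.finrank K Z := by
  let b := Module.finBasis K Z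
  have hle : Submodule.span L (Set.range Ψ) ≤ Submodule.span L (Set.range (Ψ ∘ b)) := by
    rw [Submodule.span_le]
    rintro _ ⟨x, rfl⟩
    rw [← b.sum_repr x, map_sum]
    refine Submodule.sum_mem _ fun j _ => ?_
    rw [map_smul]
    exact Submodule.smul_of_tower_mem _ _ (Submodule.subset_span ⟨j, rfl⟩)
  let y' : ι → Submodule.span L (Set.range (Ψ ∘ b)) := fun t => ⟨y t, hle (hmem t)⟩
  have hy' : LinearIndependent L y' :=
    LinearIndependent.of_comp (Submodule.subtype _) hy
  have : Module.Finite L (Submodule.span L (Set.range (Ψ ∘ b))) :=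
    Module.Finite.span_of_finite L (Set.finite_range _)
  exact hy'.fintype_card_le_finrank.trans ((finrank_range_le_card _).trans (by simp))

variable {K : Type*} [Field K] {n p i : ℕ} {M : Type*} [AddCommGroup M] [Module K M]
  [Module (Poly K n) M] [IsScalarTower K (Poly K n) M]

/-- The identity (for `none`) and the partial derivatives. -/
noncomputable def optDeriv (τ : Fin p → Fin n) : Option (Fin p) → (Poly K n →ₗ[K] Poly K n)
  | none => LinearMap.id
  | some m => (pderiv (τ m)).toLinearMap

/-- The values of an alternating map and of their first partial derivatives. -/
noncomputable def jets (π : M →ₗ[Poly K n] Poly K n) (τ : Fin p → Fin n) (i : ℕ) :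
    ((Fin n → K) [⋀^Fin i]→ₗ[K] M) →ₗ[K]
      (Option (Fin p) × (Fin i → Fin p) → FractionRing (Poly K n)) :=
  LinearMap.pi fun o => (Algebra.linearMap (Poly K n) (FractionRing (Poly K n))).restrictScalars K ∘ₗ
    optDeriv τ o.1 ∘ₗ π.restrictScalars K ∘ₗ
      { toFun := fun z => z (fun k => Pi.single (τ (o.2 k)) 1)
        map_add' := fun _ _ => rfl
        map_smul' := fun _ _ => rfl }

lemma jets_none (π : M →ₗ[Poly K n] Poly K n) (τ : Fin p → Fin n)
    (z : (Fin n → K) [⋀^Fin i]→ₗ[K] M) (f : Fin i → Fin p) :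
    jets π τ i z (none, f) =
      algebraMap (Poly K n) _ (π (z ((fun s => Pi.single (τ s) 1) ∘ f))) := rfl

lemma jets_some (π : M →ₗ[Poly K n] Poly K n) (τ : Fin p → Fin n)
    (z : (Fin n → K) [⋀^Fin i]→ₗ[K] M) (m : Fin p) (f : Fin i → Fin p) :
    jets π τ i z (some m, f) =
      algebraMap (Poly K n) _ (pderiv (τ m) (π (z ((fun s => Pi.single (τ s) 1) ∘ f)))) := rfl

/-- The least element of a nonempty subset. -/
def minElt (I : Subsets p (i + 1)) : Fin p :=
  I.1.min' (Finset.card_pos.mp (by rw [I.2]; omega))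

lemma minElt_mem (I : Subsets p (i + 1)) : minElt I ∈ I.1 := Finset.min'_mem _ _

/-- A nonempty subset without its least element. -/
def dropMin (I : Subsets p (i + 1)) : Subsets p i :=
  ⟨I.1.erase (minElt I), by rw [Finset.card_erase_of_mem (minElt_mem I), I.2]; rfl⟩

lemma minElt_notMem_range (I : Subsets p (i + 1)) : minElt I ∉ Set.range (enum (dropMin I)) := by
  rw [range_enum]
  simp [dropMin]

lemma eq_of_injective_update_extend {I J : Subsets p (i + 1)}
    (h : Function.Injective (Function.update
      (Function.extend (enum (dropMin I)) (enum (dropMin J)) id) (minElt I) (minElt J))) :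
    I = J := by
  refine Subtype.ext (Finset.eq_of_subset_of_card_le (subset_of_injective h ?_ ?_)
    (by rw [I.2, J.2])).symm
  · intro s hs
    rw [Function.update_of_ne (by rintro rfl; exact hs (minElt_mem I)), Function.extend_apply']
    · rfl
    · intro hs'
      have : s ∈ Set.range (enum (dropMin I)) := hs'
      rw [range_enum] at this
      exact hs (Finset.mem_of_mem_erase this)
  · intro x hx
    by_cases hxm : x = minElt J
    · exact ⟨minElt I, minElt_mem I, by rw [Function.update_self, hxm]⟩
    · have : x ∈ Set.range (enum (dropMin J)) := by
        rw [range_enum]; exact Finset.mem_erase.mpr ⟨hxm, hx⟩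
      obtain ⟨k, rfl⟩ := this
      have hk : enum (dropMin I) k ∈ Set.range (enum (dropMin I)) := ⟨k, rfl⟩
      refine ⟨enum (dropMin I) k, ?_, ?_⟩
      · rw [range_enum] at hk
        exact Finset.mem_of_mem_erase hk
      · rw [Function.update_of_ne (fun h => minElt_notMem_range I (by rw [← h]; exact hk)),
          (enum (dropMin I)).injective.extend_apply]

/-- The family consists of the contractions, indexed by i-subsets, and the weighted sums, indexed by
(i+1)-subsets. The value coordinates vanish on the second kind and are diagonal on the first;
suitable derivative coordinates are diagonal on the second. This triangular shape gives
independence, and Pascal's rule gives the count. -/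
theorem choose_succ_le_finrank_of_cycle {z : (Fin n → K) [⋀^Fin p]→ₗ[K] M}
    (hz : IsCycle (fun j => (X j : Poly K n)) z) (π : M →ₗ[Poly K n] Poly K n)
    (hπ : (π.restrictScalars K).compAlternatingMap z ≠ 0)
    (Z : Submodule K ((Fin n → K) [⋀^Fin i]→ₗ[K] M)) [Module.Finite K Z]
    (hZ : ∀ (σ : Fin i ↪ Fin p) (u : Fin p → Fin n → K), contract z σ u ∈ Z) :
    (p + 1).choose (i + 1) ≤ Module.finrank K Z := by
  classical
  obtain ⟨τ, hτ⟩ : ∃ τ : Fin p → Fin n, π (z fun s => Pi.single (τ s) 1) ≠ 0 := by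
    by_contra hcon
    push Not at hcon
    refine hπ ((Pi.basisFun K (Fin n)).ext_alternating fun τ _ => ?_)
    simpa using hcon τ
  set v : Fin p → Fin n → K := fun s => Pi.single (τ s) 1 with hv
  let L := FractionRing (Poly K n)
  -- For an (i+1)-subset I, the slots of I other than the least stay free, and the least slot
  -- carries e_j weighted by x_j.
  let y : Subsets p i ⊕ Subsets p (i + 1) → (Option (Fin p) × (Fin i → Fin p) → L) :=
    Sum.elim (fun I => jets π τ i (contract z (enum I) v)) fun I =>
      ∑ j, algebraMap (Poly K n) L (X j) • jets π τ i
        (contract z (enum (dropMin I)) (Function.update v (minElt I) (Pi.single j 1)))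
  -- the cycle relation, read in the slot `minElt I`
  have hcyc : ∀ (I : Subsets p (i + 1)) (f : Fin i → Fin p), ∑ j, (X j : Poly K n) *
      π (contract z (enum (dropMin I)) (Function.update v (minElt I) (Pi.single j 1)) (v ∘ f)) =
        0 := by
    intro I f
    have := congrArg π (hz (minElt I) (Function.extend (enum (dropMin I)) (v ∘ f) v))
    simp only [map_sum, map_smul, smul_eq_mul, map_zero] at this
    simpa only [contract_apply, extend_update_of_notMem _ _ _ (minElt_notMem_range I)] using this
  have hy_none : ∀ (I : Subsets p (i + 1)) (f : Fin i → Fin p), y (Sum.inr I) (none, f) = 0 := by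
    intro I f
    simp only [y, Sum.elim_inr, Finset.sum_apply, Pi.smul_apply, jets_none, smul_eq_mul]
    rw [← map_zero (algebraMap (Poly K n) L), ← hcyc I f, map_sum]
    simp only [map_mul]
    rfl
  -- Differentiating the cycle relation in direction τ (minElt J) gives Σ x_j ∂(…) = -(the term with
  -- e_j in that direction). That term is z evaluated at some of the v_s, with a repetition unless I
  -- = J.
  have hy_some : ∀ I J : Subsets p (i + 1),
      y (Sum.inr I) (some (minElt J), enum (dropMin J)) =
        -algebraMap (Poly K n) L (if I = J then π (z v) else 0) := by
    intro I J
    simp only [y, Sum.elim_inr, Finset.sum_apply, Pi.smul_apply, jets_some, smul_eq_mul]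
    have h1 := congrArg (pderiv (τ (minElt J))) (hcyc I (enum (dropMin J)))
    simp only [map_sum, Derivation.leibniz, smul_eq_mul, map_zero, pderiv_X] at h1
    rw [Finset.sum_add_distrib] at h1
    have h2 : ∑ j, π (contract z (enum (dropMin I))
        (Function.update v (minElt I) (Pi.single j 1)) (v ∘ enum (dropMin J))) *
          (Pi.single (τ (minElt J)) 1 : Fin n → Poly K n) j =
        if I = J then π (z v) else 0 := by
      rw [Finset.sum_eq_single (τ (minElt J))]
      · rw [Pi.single_eq_same, mul_one, contract_apply,
          extend_update_of_notMem _ _ _ (minElt_notMem_range I), extend_comp_comp]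
        have h3 : Function.update (v ∘ Function.extend (enum (dropMin I)) (enum (dropMin J)) id)
            (minElt I) (Pi.single (τ (minElt J)) 1) = v ∘ Function.update
              (Function.extend (enum (dropMin I)) (enum (dropMin J)) id)
                (minElt I) (minElt J) := by
          rw [Function.comp_update]
        rw [h3]
        split_ifs with h
        · subst h
          rw [extend_self]
          congr 2
          ext1 s
          by_cases hs : s = minElt I
          · subst hs; simp
          · simp [Function.update_of_ne hs]
        · rw [map_comp_eq_zero z v fun hinj => h (eq_of_injective_update_extend hinj), map_zero]
      · intro j _ hj
        rw [Pi.single_eq_of_ne hj, mul_zero]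
      · simp
    rw [h2] at h1
    rw [← map_neg, ← eq_neg_of_add_eq_zero_left h1, map_sum]
    simp only [map_mul]
    rfl
  have hli : LinearIndependent L y := by
    rw [Fintype.linearIndependent_iff]
    intro g hg
    have hg0 : algebraMap (Poly K n) (FractionRing (Poly K n)) (π (z v)) ≠ 0 :=
      (map_ne_zero_iff _ (IsFractionRing.injective (Poly K n) (FractionRing (Poly K n)))).mpr hτ
    have hinl : ∀ I, g (Sum.inl I) = 0 := by
      intro J
      have := congrFun hg (none, enum J)
      rw [Fintype.sum_sum_type] at this
      simp only [Pi.add_apply, Finset.sum_apply, Pi.smul_apply, hy_none, smul_zero,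
        Finset.sum_const_zero, add_zero, Pi.zero_apply] at this
      simp only [y, Sum.elim_inl, jets_none, ← hv, contract_enum_apply] at this
      rw [Finset.sum_eq_single J] at this
      · rw [if_pos rfl] at this
        exact (mul_eq_zero.mp this).resolve_right hg0
      · intro I _ hI
        simp [hI]
      · simp
    have hinr : ∀ I, g (Sum.inr I) = 0 := by
      intro J
      have := congrFun hg (some (minElt J), enum (dropMin J))
      rw [Fintype.sum_sum_type] at this
      simp only [hinl, zero_smul, Finset.sum_const_zero, zero_add, Finset.sum_apply,
        Pi.smul_apply, hy_some, Pi.zero_apply] at this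
      rw [Finset.sum_eq_single J] at this
      · simpa [hτ] using this
      · intro I _ hI
        simp [hI]
      · simp
    rintro (I | I)
    · exact hinl I
    · exact hinr I
  have hmem : ∀ t, y t ∈ Submodule.span L (Set.range (jets π τ i ∘ₗ Z.subtype)) := by
    rintro (I | I)
    · exact Submodule.subset_span ⟨⟨_, hZ (enum I) v⟩, rfl⟩
    · exact Submodule.sum_mem _ fun j _ => Submodule.smul_mem _ _
        (Submodule.subset_span ⟨⟨_, hZ (enum (dropMin I)) _⟩, rfl⟩)
  have := card_le_finrank_of_mem_span (jets π τ i ∘ₗ Z.subtype) hli hmem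
  rwa [Fintype.card_sum, Fintype.card_finset_len, Fintype.card_finset_len, Fintype.card_fin,
    ← Nat.choose_succ_succ] at this

end TorsionFree

/-! ### Vanishing of Koszul homology along kernels. -/

section Acyclic

variable {K R : Type*} [Field K] [CommRing R] [Algebra K R] {q : ℕ}
  {B C : Type*} [AddCommGroup B] [Module K B] [Module R B] [IsScalarTower K R B]
  [AddCommGroup C] [Module K C] [Module R C] [IsScalarTower K R C]

variable (K B) in
/-- The Koszul homology of `B` with respect to `f` vanishes in every positive degree greater than
`q - k`. -/
def KoszulAcyclic (f : Fin q → R) (k : ℕ) : Prop :=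
  ∀ a, q < a + 1 + k → ∀ z : (Fin q → K) [⋀^Fin (a + 1)]→ₗ[K] B, koszulD f a z = 0 →
    ∃ w : (Fin q → K) [⋀^Fin (a + 2)]→ₗ[K] B, koszulD f (a + 1) w = z

/-- More than q vectors in K^q are dependent, so the chains themselves vanish. -/
lemma koszulAcyclic_zero (f : Fin q → R) : KoszulAcyclic K B f 0 := by
  intro a ha z _
  refine ⟨0, ?_⟩
  rw [koszulD_zero]
  ext1 v
  refine (z.map_linearDependent v fun hv => ?_).symm
  have := hv.fintype_card_le_finrank
  rw [Module.finrank_fin_fun, Fintype.card_fin] at this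
  omega

lemma KoszulAcyclic.of_equiv {f : Fin q → R} {k : ℕ} (h : KoszulAcyclic K C f k)
    (φ : B ≃ₗ[R] C) : KoszulAcyclic K B f k := by
  intro a ha z hz
  let ψ : B →ₗ[K] C := φ.toLinearMap.restrictScalars K
  let ψ' : C →ₗ[K] B := φ.symm.toLinearMap.restrictScalars K
  obtain ⟨w, hw⟩ := h a ha (ψ.compAlternatingMap z) (by
    rw [koszulD_compAlternatingMap f ψ fun j m => φ.map_smul _ _, hz]
    ext1 v
    simp)
  refine ⟨ψ'.compAlternatingMap w, ?_⟩
  rw [koszulD_compAlternatingMap f ψ' fun j m => φ.symm.map_smul _ _, hw]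
  ext1 v
  exact φ.symm_apply_apply _

/-- In the long exact sequence of 0 → ker φ → B → C → 0, the homology of ker φ in degree a+1 sits
between that of C in degree a+2 and that of B in degree a+1, and both vanish. The shift by one
degree is the gain from k to k+1. -/
theorem KoszulAcyclic.ker {f : Fin q → R} {k : ℕ} (h : KoszulAcyclic K C f k)
    (hB : IsRegularSeq f B) (φ : B →ₗ[R] C) (hφ : Function.Surjective φ) :
    KoszulAcyclic K (LinearMap.ker φ) f (k + 1) := by
  intro a ha z hz
  let ι : LinearMap.ker φ →ₗ[K] B := (LinearMap.ker φ).subtype.restrictScalars K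
  let ψ : B →ₗ[K] C := φ.restrictScalars K
  have hι : ∀ (j : Fin q) (m : LinearMap.ker φ), ι (f j • m) = f j • ι m := fun _ _ => rfl
  have hψ : ∀ (j : Fin q) (m : B), ψ (f j • m) = f j • ψ m := fun _ _ => φ.map_smul _ _
  obtain ⟨w, hw⟩ := exists_koszulD_eq hB (ι.compAlternatingMap z) (by
    rw [koszulD_compAlternatingMap f ι hι, hz]
    ext1 v
    simp)
  obtain ⟨y, hy⟩ := h (a + 1) (by omega) (ψ.compAlternatingMap w) (by
    rw [koszulD_compAlternatingMap f ψ hψ, hw]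
    ext1 v
    exact (z v).2)
  obtain ⟨y', rfl⟩ := exists_compAlternatingMap_eq ψ y fun v => hφ (y v)
  obtain ⟨u, hu⟩ := exists_compAlternatingMap_eq ι (w - koszulD f (a + 2) y') (by
    intro v
    refine ⟨⟨(w - koszulD f (a + 2) y') v, ?_⟩, rfl⟩
    rw [koszulD_compAlternatingMap f ψ hψ] at hy
    have h1 := DFunLike.congr_fun hy v
    rw [LinearMap.mem_ker, AlternatingMap.sub_apply, map_sub]
    exact sub_eq_zero.mpr h1.symm)
  refine ⟨u, ?_⟩
  have h2 : ι.compAlternatingMap (koszulD f (a + 1) u) = ι.compAlternatingMap z := by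
    rw [← koszulD_compAlternatingMap f ι hι, hu, koszulD_sub, hw, koszulD_koszulD, sub_zero]
  ext1 v
  exact Subtype.ext (DFunLike.congr_fun h2 v)

end Acyclic

/-! ### Koszul homology of syzygy modules. -/

section Syzygies

variable {K : Type*} [Field K] {n q : ℕ} {N : Type*} [AddCommGroup N] [Module K N]
  [Module (Poly K n) N] [IsScalarTower K (Poly K n) N] {𝒩 : ℤ → Submodule K N}

lemma koszulAcyclic_ker_aug (F : GradedFreeResolution (n := n) 𝒩) {f : Fin q → Poly K n}
    (hf : IsRegularSeq f (Poly K n)) : KoszulAcyclic K (LinearMap.ker F.aug) f 1 :=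
  (koszulAcyclic_zero f).ker (hf.pi _) F.aug F.aug_surjective

/-- Exactness makes each differential a surjection from a free module onto the previous syzygy, so
every step of the resolution gains one degree. -/
lemma koszulAcyclic_ker_d (F : GradedFreeResolution (n := n) 𝒩) {f : Fin q → Poly K n}
    (hf : IsRegularSeq f (Poly K n)) (j : ℕ) :
    KoszulAcyclic K (LinearMap.ker (F.d j)) f (j + 2) := by
  induction j with
  | zero =>
    have h := (koszulAcyclic_ker_aug F hf).of_equiv
      (LinearEquiv.ofEq _ _ F.exact_aug.linearMap_ker_eq.symm)
    have := h.ker (hf.pi _) (F.d 0).rangeRestrict (F.d 0).surjective_rangeRestrict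
    exact this.of_equiv (LinearEquiv.ofEq _ _ (F.d 0).ker_rangeRestrict.symm)
  | succ j ih =>
    have h := ih.of_equiv (LinearEquiv.ofEq _ _ (F.exact_d j).linearMap_ker_eq.symm)
    have := h.ker (hf.pi _) (F.d (j + 1)).rangeRestrict (F.d (j + 1)).surjective_rangeRestrict
    exact this.of_equiv (LinearEquiv.ofEq _ _ (F.d (j + 1)).ker_rangeRestrict.symm)

end Syzygies

/-! ### The bound for higher syzygies, by the rank of a cycle. -/

section Rank

variable {K : Type*} [Field K] {n : ℕ} {M : Type*} [AddCommGroup M] [Module K M]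

lemma map_update_eq_zero_of_curryLeft {V : Type*} [AddCommGroup V] [Module K V] {a : ℕ}
    (z : V [⋀^Fin (a + 1)]→ₗ[K] M) {x : V} (hx : z.curryLeft x = 0) (w : Fin (a + 1) → V)
    (s : Fin (a + 1)) : z (Function.update w s x) = 0 := by
  rw [map_update_eq_sign_smul, ← AlternatingMap.curryLeft_apply_apply, hx]
  simp

lemma map_eq_of_curryLeft_sub {V : Type*} [AddCommGroup V] [Module K V] {a : ℕ}
    (z : V [⋀^Fin (a + 1)]→ₗ[K] M) (w w' : Fin (a + 1) → V)
    (h : ∀ s, z.curryLeft (w' s - w s) = 0) : z w' = z w := by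
  classical
  suffices ∀ T : Finset (Fin (a + 1)), z (T.piecewise w' w) = z w by
    simpa using this Finset.univ
  intro T
  induction T using Finset.induction_on with
  | empty => simp
  | insert s T hs ih =>
    rw [Finset.piecewise_insert, ← sub_add_cancel (w' s) (w s), AlternatingMap.map_update_add,
      map_update_eq_zero_of_curryLeft z (h s), zero_add, ← ih]
    congr 1
    exact Function.update_eq_self_iff.mpr (Finset.piecewise_eq_of_notMem _ _ _ hs).symm

lemma linForm_mem (v : Fin n → K) : linForm v ∈ stdGrading K n 1 := by
  rw [linForm_apply]
  exact Submodule.sum_mem _ fun j _ => Submodule.smul_mem _ _ (X_mem_stdGrading j)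

variable [Module (Poly K n) M] [IsScalarTower K (Poly K n) M] {ℳ : ℤ → Submodule K M}
  [DirectSum.Decomposition ℳ] [SetLike.GradedSMul (stdGrading K n) ℳ]

/-- The partial evaluations z(u, ·) are themselves linear cycles, so it suffices to bound the rank q
of u ↦ z(u, ·) from below. Since z depends only on arguments modulo the kernel of this map, it is
the pullback of an alternating map on K^q. -/
theorem add_le_finrank_linearCycles (G : GradedFreeResolution (n := n) ℳ) {k a : ℕ}
    (hacyc : ∀ (q : ℕ) (c : Fin q → Fin n → K), LinearIndependent K c →
      KoszulAcyclic K M (fun s => linForm (c s)) k)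
    {z : (Fin n → K) [⋀^Fin (a + 1)]→ₗ[K] M} (hz : z ∈ linearCycles n ℳ (a + 1)) (hz0 : z ≠ 0)
    [Module.Finite K (linearCycles n ℳ a)] :
    a + 1 + k ≤ Module.finrank K (linearCycles n ℳ a) := by
  have hrange : LinearMap.range z.curryLeft ≤ linearCycles n ℳ a := by
    rintro _ ⟨x, rfl⟩
    refine ⟨fun v => hz.1 _, ?_⟩
    cases a with
    | zero => exact isCycle_of_isEmpty _ _
    | succ a =>
      rw [isCycle_iff_koszulD, ← neg_eq_zero, ← curryLeft_koszulD,
        (isCycle_iff_koszulD _ z).mp hz.2]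
      simp
  refine le_trans ?_ (Submodule.finrank_mono hrange)
  set q := Module.finrank K (LinearMap.range z.curryLeft) with hq
  by_contra hlt
  let e : LinearMap.range z.curryLeft ≃ₗ[K] (Fin q → K) :=
    (Module.finBasis K (LinearMap.range z.curryLeft)).equivFun
  let ρ : (Fin n → K) →ₗ[K] (Fin q → K) := e.toLinearMap ∘ₗ z.curryLeft.rangeRestrict
  have hρs : Function.Surjective ρ :=
    e.surjective.comp z.curryLeft.surjective_rangeRestrict
  have hρ : ∀ x, ρ x = 0 → z.curryLeft x = 0 := by
    intro x hx
    have : z.curryLeft.rangeRestrict x = 0 := e.map_eq_zero_iff.mp hx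
    exact congrArg Subtype.val this
  obtain ⟨σ, hσ⟩ := ρ.exists_rightInverse_of_surjective (LinearMap.range_eq_top.mpr hρs)
  replace hσ : ∀ x, ρ (σ x) = x := fun x => LinearMap.congr_fun hσ x
  have hσρ : ∀ x, z.curryLeft (σ (ρ x) - x) = 0 := fun x =>
    hρ _ (by rw [map_sub, hσ, sub_self])
  -- Row s of the matrix of ρ. With these rows as linear forms, Σ_s ℓ_s z'(e_s, ·) regroups to Σ_j
  -- x_j z(σ ρ e_j, ·) = Σ_j x_j z(e_j, ·), so the cycle relation descends to z'.
  let c : Fin q → Fin n → K := fun s j => ρ (Pi.single j 1) s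
  have hc : LinearIndependent K c := by
    rw [Fintype.linearIndependent_iff]
    intro g hg s
    have h1 : ∑ t, g t • (LinearMap.proj t ∘ₗ ρ : (Fin n → K) →ₗ[K] K) = 0 := by
      refine (Pi.basisFun K (Fin n)).ext fun j => ?_
      have := congrFun hg j
      simpa [c, LinearMap.sum_apply] using this
    have := LinearMap.congr_fun h1 (σ (Pi.single s 1))
    simpa [LinearMap.sum_apply, hσ, Pi.single_apply] using this
  let z' : (Fin q → K) [⋀^Fin (a + 1)]→ₗ[K] M := z.compLinearMap σ
  have hz' : koszulD (fun s => linForm (c s)) a z' = 0 := by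
    ext1 u
    have h0 := DFunLike.congr_fun ((isCycle_iff_koszulD _ z).mp hz.2) (σ ∘ u)
    rw [koszulD_apply, AlternatingMap.zero_apply] at h0 ⊢
    rw [← h0]
    have h1 : ∀ s, z' (Matrix.vecCons (Pi.single s 1) u) =
        z.curryLeft (σ (Pi.single s 1)) (σ ∘ u) := fun s =>
      DFunLike.congr_fun (AlternatingMap.curryLeft_compLinearMap σ z (Pi.single s 1)) u
    simp only [h1, linForm_apply, Finset.sum_smul]
    rw [Finset.sum_comm]
    refine Finset.sum_congr rfl fun j _ => ?_
    simp only [smul_assoc, smul_comm (c _ j) (X j : Poly K n)]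
    rw [← Finset.smul_sum]
    congr 1
    have h2 : z.curryLeft (σ (ρ (Pi.single j 1))) = z.curryLeft (Pi.single j 1) := by
      rw [← sub_eq_zero, ← map_sub, hσρ]
    rw [← AlternatingMap.curryLeft_apply_apply, ← h2]
    have h3 : σ (ρ (Pi.single j 1)) = ∑ s, c s j • σ (Pi.single s 1) := by
      conv_lhs => rw [pi_eq_sum_univ' (ρ (Pi.single j 1)), map_sum]
      refine Finset.sum_congr rfl fun s _ => ?_
      rw [map_smul]
    rw [h3, map_sum, alternatingMap_sum_apply]
    exact Finset.sum_congr rfl fun s _ => by rw [map_smul, AlternatingMap.smul_apply]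
  obtain ⟨w, hw⟩ := hacyc q c hc a (by omega) z' hz'
  refine hz0 ?_
  ext1 u
  have h1 : z (σ ∘ ρ ∘ u) = z u := map_eq_of_curryLeft_sub z u (σ ∘ ρ ∘ u) fun s => hσρ (u s)
  have h2 : z (σ ∘ ρ ∘ u) = koszulD (fun s => linForm (c s)) (a + 1) w (ρ ∘ u) := by
    rw [hw]; rfl
  rw [AlternatingMap.zero_apply, ← h1]
  -- A boundary for forms of degree one with value in the initial degree must vanish.
  have h3 := hz.1 (σ ∘ ρ ∘ u)
  rw [h2, koszulD_apply] at h3 ⊢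
  exact eq_zero_of_initialDegree G _ _ (fun s => linForm_mem (c s)) _ h3

end Rank

end LinearStrand

/-! ### The three bounds. -/

theorem corollary2p12 {K : Type*} [Field K] (n : ℕ)
    -- a finitely generated graded `S`-module `M`
    {M : Type*} [AddCommGroup M] [Module K M] [Module (LinearStrand.Poly K n) M]
    [IsScalarTower K (LinearStrand.Poly K n) M] [Module.Finite (LinearStrand.Poly K n) M]
    (ℳ : ℤ → Submodule K M) [DirectSum.Decomposition ℳ]
    [SetLike.GradedSMul (LinearStrand.stdGrading K n) ℳ]
    -- a finitely generated graded `S`-module `N` with a minimal graded free resolution `F`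
    {N : Type*} [AddCommGroup N] [Module K N] [Module (LinearStrand.Poly K n) N]
    [IsScalarTower K (LinearStrand.Poly K n) N] [Module.Finite (LinearStrand.Poly K n) N]
    (𝒩 : ℤ → Submodule K N) [DirectSum.Decomposition 𝒩]
    [SetLike.GradedSMul (LinearStrand.stdGrading K n) 𝒩]
    (F : LinearStrand.GradedFreeResolution (n := n) 𝒩) (hF : F.IsMinimal)
    -- `M` is the `k`-th syzygy module in `F`
    (k : ℕ) (hM : F.IsSyzygy k ℳ)
    (p : ℕ) (hpn : p ≤ n) (hp : LinearStrand.linBetti n ℳ p ≠ 0) :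
    (k = 0 → ∀ i ≤ p, p.choose i ≤ LinearStrand.linBetti n ℳ i) ∧
    (k = 1 → ∀ i ≤ p, (p + 1).choose (i + 1) ≤ LinearStrand.linBetti n ℳ i) ∧
    (1 < k → 0 < p → p + k ≤ LinearStrand.linBetti n ℳ (p - 1)) := by
  obtain ⟨⟨z, hz, hz0⟩, ⟨G⟩, hfin⟩ :=
    LinearStrand.finite_linearCycles_of_linBetti_ne_zero (n := n) (ℳ := ℳ) hp
  obtain ⟨v, hv⟩ : ∃ v, z v ≠ 0 := by
    by_contra h
    push Not at h
    exact hz0 (AlternatingMap.ext h)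
  refine ⟨fun _ i _ => ?_, ?_, ?_⟩
  · have := (hfin i).1
    refine le_trans ?_ (hfin i).2
    have hli : LinearIndependent K fun I : LinearStrand.Subsets p i =>
        (⟨_, LinearStrand.contract_mem_linearCycles hz (LinearStrand.enum I) v⟩ :
          LinearStrand.linearCycles n ℳ i) :=
      LinearIndependent.of_comp (Submodule.subtype _)
        (LinearStrand.linearIndependent_contract z hv)
    have := hli.fintype_card_le_finrank
    rwa [Fintype.card_finset_len, Fintype.card_fin] at this
  · rintro rfl i _
    have := (hfin i).1
    refine le_trans ?_ (hfin i).2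
    obtain ⟨φ, -⟩ := hM
    -- A coordinate of the free module containing M that does not vanish on z v serves as the
    -- functional π from M to S.
    obtain ⟨a, ha⟩ : ∃ a, (φ (z v) : Fin (F.rank 0) → LinearStrand.Poly K n) a ≠ 0 := by
      by_contra h
      push Not at h
      exact hv (φ.map_eq_zero_iff.mp (Subtype.ext (funext h)))
    refine LinearStrand.choose_succ_le_finrank_of_cycle hz.2
      (LinearMap.proj a ∘ₗ (LinearMap.ker F.aug).subtype ∘ₗ φ.toLinearMap) (fun h => ha ?_) _
      (fun σ u => LinearStrand.contract_mem_linearCycles hz σ u)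
    exact DFunLike.congr_fun h v
  · intro hk hp0
    obtain ⟨j, rfl⟩ : ∃ j, k = j + 2 := ⟨k - 2, by omega⟩
    obtain ⟨a, rfl⟩ : ∃ a, p = a + 1 := ⟨p - 1, by omega⟩
    have := (hfin a).1
    refine le_trans ?_ (hfin a).2
    obtain ⟨φ, -⟩ := hM
    exact LinearStrand.add_le_finrank_linearCycles G (fun q c hc =>
      (LinearStrand.koszulAcyclic_ker_d F
        (LinearStrand.isRegularSeq_linForm hc) j).of_equiv φ) hz hz0
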